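/- Let $n\ge 2$, let $\theta$ be a real antisymmetric $n\times n$ matrix with columns $\theta_1,\dots,\theta_n$, and let $C(\mathbb{T}^n_\theta)$ be the $C^*$-algebra of operators on $L_2(\mathbb{T}^n)$, $\mathbb T^n=\mathbb R^n/(2\pi\mathbb Z)^n$ (with normalized Lebesgue measure), generated by the unitaries $(U_j\xi)(x)=e^{ix_j}\xi(x+\pi\theta_j)$, $j=1,\dots,n$. Put $U^k=U_1^{k_1}\cdots U_n^{k_n}$ for $k\in\mathbb{Z}^n$, and let $\tau(u)=\langle u1,1\rangle$ be the standard tracial state. Let $L_2(\mathbb{T}^n_\theta)$ be the completion of $C(\mathbb{T}^n_\theta)$ for the inner product $\langle u,v\rangle=\tau(uv^*)$ and $L_1(\mathbb{T}^n_\theta)$ its completion for the norm $\|x\|_{L_1}=\tau(|x|)$; products by elements of $C(\mathbb{T}^n_\theta)$ and the trace $\tau$ extend to these spaces by continuity. Let $\alpha_s$, $s\in\mathbb R^n$, be the action of $\mathbb R^n$ on $C(\mathbb{T}^n_\theta)$ with $\alpha_s(U^k)=e^{is\cdot k}U^k$, let $C^\infty(\mathbb{T}^n_\theta)$ be the algebra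 of all $u\in C(\mathbb{T}^n_\theta)$ such that $s\mapsto\alpha_s(u)$ is smooth, let $\delta_j(u)=\frac1i\partial_{s_j}\alpha_s(u)|_{s=0}$, and give $C^\infty(\mathbb{T}^n_\theta)$ the topology defined by the seminorms $u\mapsto\|\delta^\alpha u\|$. For $m\in\mathbb{R}$, $\mathbb{S}^{m}(\mathbb{T}^n_\theta\times\mathbb{R}^n)$ is the space of smooth maps $\rho:\mathbb{R}^n\to C^\infty(\mathbb{T}^n_\theta)$ such that for all multi-orders $\alpha,\beta$ there is a constant $C_{\alpha\beta}$ with $\|\delta^\alpha\partial_\xi^\beta\rho(\xi)\|\le C_{\alpha\beta}(1+|\xi|)^{m-|\beta|}$ for all $\xi\in\mathbb R^n$. The associated pseudodifferential operator is $P_\rho u=\sum_{k\in\mathbb{Z}^n}u_k\,\rho(k)U^k$ for $u\in C^\infty(\mathbb{T}^n_\theta)$, where $u_k=\tau(u(U^k)^*)$. (1) Let $m>n$, $\rho\in\mathbb{S}^{-m}(\mathbb{T}^n_\theta\times\mathbb{R}^n)$ and $x\in L_2(\mathbb{T}^n_\theta)$. Then the operator $u\mapsto \lambda(x)P_\rho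 u:=x\,(P_\rho u)$, $u\in C^\infty(\mathbb{T}^n_\theta)$, extends uniquely to a bounded operator $\lambda(x)P_\rho$ on $L_2(\mathbb{T}^n_\theta)$; this operator is trace class, and $$\operatorname{Tr}\big[\lambda(x)P_\rho\big]=\sum_{k\in\mathbb{Z}^n}\tau\big[x\rho(k)\big],$$ where the series converges absolutely. (2) Let $m>n/2$, $\rho,\sigma\in\mathbb{S}^{-m}(\mathbb{T}^n_\theta\times\mathbb{R}^n)$ and $x\in L_1(\mathbb{T}^n_\theta)$. Then there is a unique bounded operator $P_\sigma^*\lambda(x)P_\rho$ on $L_2(\mathbb{T}^n_\theta)$ such that $$\big\langle P_\sigma^*\lambda(x)P_\rho u,v\big\rangle=\tau\big[(P_\sigma v)^*\,x\,(P_\rho u)\big]\qquad \text{for all } u,v\in C^\infty(\mathbb{T}^n_\theta);$$ this operator is trace class, and $$\operatorname{Tr}\big[P_\sigma^*\lambda(x)P_\rho\big]=\sum_{k\in\mathbb{Z}^n}\tau\big[x\rho(k)\sigma(k)^*\big],$$ where the series converges absolutely. In particular, $\operatorname{Tr}[P_\rho^*\lambda(x)P_\rho]=\sum_{k\in\mathbb{Z}^n}\tau\big[x\,|\rho(k)^*|^2\big]$,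 where $|a|^2=a^*a$, so that $|\rho(k)^*|^2=\rho(k)\rho(k)^*$. -/

import Mathlib

open MeasureTheory
open scoped ENNReal ComplexOrder InnerProductSpace

noncomputable section

namespace NCTorus

/-! ### Tracial positive functionals on a unital C⋆-algebra -/

section Tracial

variable {A : Type*} [CStarAlgebra A] [PartialOrder A] [StarOrderedRing A]

lemma norm_toPreGNS_mul_le (τ : A →ₚ[ℂ] ℂ) (a b : A) :
    ‖τ.toPreGNS (a * b)‖ ≤ ‖a‖ * ‖τ.toPreGNS b‖ := by
  have h := (τ.leftMulMapPreGNS a).le_opNorm (τ.toPreGNS b)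
  have h2 : ‖τ.leftMulMapPreGNS a‖ ≤ ‖a‖ := LinearMap.mkContinuous_norm_le _ (norm_nonneg _) _
  exact h.trans (mul_le_mul_of_nonneg_right h2 (norm_nonneg _))

lemma norm_toPreGNS_star (τ : A →ₚ[ℂ] ℂ) (hτ : ∀ a b, τ (a * b) = τ (b * a)) (a : A) :
    ‖τ.toPreGNS (star a)‖ = ‖τ.toPreGNS a‖ := by
  rw [PositiveLinearMap.preGNS_norm_def, PositiveLinearMap.preGNS_norm_def]
  simp [hτ a (star a)]

lemma norm_apply_star_mul_le (τ : A →ₚ[ℂ] ℂ) (a b : A) :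
    ‖τ (star a * b)‖ ≤ ‖τ.toPreGNS a‖ * ‖τ.toPreGNS b‖ :=
  norm_inner_le_norm (𝕜 := ℂ) (τ.toPreGNS a) (τ.toPreGNS b)

lemma norm_toPreGNS_mul_le_right (τ : A →ₚ[ℂ] ℂ) (hτ : ∀ a b, τ (a * b) = τ (b * a)) (a b : A) :
    ‖τ.toPreGNS (b * a)‖ ≤ ‖a‖ * ‖τ.toPreGNS b‖ := by
  rw [← norm_toPreGNS_star τ hτ, star_mul, ← norm_toPreGNS_star τ hτ b, ← norm_star a]
  exact norm_toPreGNS_mul_le τ _ _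

lemma norm_apply_le (τ : A →ₚ[ℂ] ℂ) (a : A) :
    ‖τ a‖ ≤ ‖a‖ * ‖τ.toPreGNS 1‖ ^ 2 := by
  have h := norm_apply_star_mul_le τ 1 (a * 1)
  have h2 := norm_toPreGNS_mul_le τ a 1
  simp only [star_one, one_mul, mul_one] at h h2
  nlinarith [norm_nonneg (τ.toPreGNS 1)]

/-- An approximate polar decomposition inside the C⋆-algebra. -/
lemma exists_approx_polar (x : A) {ε : ℝ} (hε : 0 < ε) :
    ∃ u : A, ‖u‖ ≤ 1 ∧ ‖x - u * CFC.abs x‖ ≤ ε ∧ ‖CFC.abs x - star u * x‖ ≤ ε := by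
  set h := CFC.abs x with hh
  have hpos : 0 ≤ h := CFC.abs_nonneg x
  have hsa : IsSelfAdjoint h := hpos.isSelfAdjoint
  have hspec : ∀ t ∈ spectrum ℝ h, 0 ≤ t := fun t ht => spectrum_nonneg_of_nonneg hpos ht
  have hc : ContinuousOn (fun t : ℝ => (t + ε)⁻¹) (spectrum ℝ h) := by
    apply ContinuousOn.inv₀ (by fun_prop)
    intro t ht
    have := hspec t ht
    positivity
  set g := cfc (fun t : ℝ => (t + ε)⁻¹) h with hg
  have hgsa : IsSelfAdjoint g := cfc_predicate _ _
  have hid : h = cfc (fun t : ℝ => t) h := (cfc_id' ℝ h).symm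
  have hxx : star x * x = h * h := (CFC.abs_mul_abs x).symm
  have hhg : h * g = cfc (fun t : ℝ => t * (t + ε)⁻¹) h := by
    rw [cfc_mul (fun t : ℝ => t) _ h (by fun_prop) hc, ← hid]
  have hcomm : h * g = g * h := by
    have := cfc_commute_cfc (fun t : ℝ => t) (fun t : ℝ => (t + ε)⁻¹) h
    rw [← hid] at this
    exact this
  have hnorm : ∀ v : A, ‖x * v‖ = ‖h * v‖ := by
    intro v
    have : ‖x * v‖ * ‖x * v‖ = ‖h * v‖ * ‖h * v‖ := by
      rw [← CStarRing.norm_star_mul_self, ← CStarRing.norm_star_mul_self, star_mul, star_mul,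
        hsa.star_eq]
      congr 1
      rw [mul_assoc, ← mul_assoc (star x), hxx]
      simp only [mul_assoc]
    exact (mul_self_inj (norm_nonneg _) (norm_nonneg _)).1 this
  have hkey : ‖h - h * g * h‖ ≤ ε := by
    have : h - h * g * h = cfc (fun t : ℝ => t - t * (t + ε)⁻¹ * t) h := by
      rw [cfc_sub (fun t : ℝ => t) (fun t => t * (t + ε)⁻¹ * t) h (by fun_prop)
        ((continuousOn_id.mul hc).mul continuousOn_id),
        cfc_mul (fun t : ℝ => t * (t + ε)⁻¹) (fun t => t) h (continuousOn_id.mul hc)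
        (by fun_prop), ← hhg, ← hid]
    rw [this]
    apply norm_cfc_le hε.le
    intro t ht
    have h0 := hspec t ht
    have : t - t * (t + ε)⁻¹ * t = t * ε / (t + ε) := by field_simp; ring
    rw [this, Real.norm_of_nonneg (by positivity), div_le_iff₀ (by positivity)]
    nlinarith
  refine ⟨x * g, ?_, ?_, ?_⟩
  · rw [hnorm, hhg]
    apply norm_cfc_le zero_le_one
    intro t ht
    have h0 := hspec t ht
    rw [Real.norm_of_nonneg (by positivity), ← div_eq_mul_inv, div_le_one (by positivity)]
    linarith
  · have : x - x * g * h = x * (1 - g * h) := by rw [mul_sub, mul_one, mul_assoc]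
    rw [this, hnorm, mul_sub, mul_one, ← mul_assoc]
    exact hkey
  · rw [star_mul, hgsa.star_eq, mul_assoc, hxx, ← mul_assoc, ← hcomm]
    exact hkey

lemma norm_apply_mul_le (τ : A →ₚ[ℂ] ℂ) (hτ : ∀ a b, τ (a * b) = τ (b * a)) (y x : A) :
    ‖τ (y * x)‖ ≤ ‖y‖ * (τ (CFC.abs x)).re := by
  set h := CFC.abs x with hh
  have hpos : 0 ≤ h := CFC.abs_nonneg x
  set k := CFC.sqrt h with hk
  have hkk : k * k = h := CFC.sqrt_mul_sqrt_self h hpos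
  have hksa : star k = k := (CFC.sqrt_nonneg h).isSelfAdjoint.star_eq
  have hknorm : ‖τ.toPreGNS k‖ ^ 2 = (τ h).re := by
    have := τ.preGNS_norm_sq (τ.toPreGNS k)
    rw [PositiveLinearMap.ofPreGNS_toPreGNS, hksa, hkk] at this
    rw [← this, ← Complex.ofReal_pow, Complex.ofReal_re]
  have hbd : ∀ u : A, ‖u‖ ≤ 1 → ‖τ (y * u * h)‖ ≤ ‖y‖ * (τ h).re := by
    intro u hu
    have h1 : y * u * h = star (star (y * u * k)) * k := by
      rw [star_star, mul_assoc (y * u), hkk]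
    rw [h1]
    refine (norm_apply_star_mul_le τ _ _).trans ?_
    rw [norm_toPreGNS_star τ hτ, ← hknorm]
    have h2 := norm_toPreGNS_mul_le τ (y * u) k
    have h3 : ‖y * u‖ ≤ ‖y‖ := (norm_mul_le _ _).trans (by nlinarith [norm_nonneg y])
    have h4 := norm_nonneg (τ.toPreGNS k)
    nlinarith
  set M := ‖τ.toPreGNS 1‖ ^ 2
  refine le_of_forall_pos_le_add fun δ hδ => ?_
  obtain ⟨u, hu, hxu, -⟩ := exists_approx_polar x (ε := δ / (‖y‖ * M + 1)) (by positivity)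
  have e : y * x = y * u * h + y * (x - u * h) := by rw [mul_sub, ← mul_assoc]; abel
  rw [e, map_add]
  refine (norm_add_le _ _).trans (add_le_add (hbd u hu) ?_)
  refine (norm_apply_le τ _).trans ?_
  have h5 : ‖y * (x - u * h)‖ ≤ ‖y‖ * (δ / (‖y‖ * M + 1)) :=
    (norm_mul_le _ _).trans (mul_le_mul_of_nonneg_left hxu (norm_nonneg _))
  calc ‖y * (x - u * h)‖ * M ≤ ‖y‖ * (δ / (‖y‖ * M + 1)) * M :=
        mul_le_mul_of_nonneg_right h5 (by positivity)
    _ = δ * ((‖y‖ * M) / (‖y‖ * M + 1)) := by ring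
    _ ≤ δ * 1 := by
        apply mul_le_mul_of_nonneg_left _ hδ.le
        rw [div_le_one (by positivity)]; linarith
    _ = δ := mul_one _

lemma re_apply_abs_le (τ : A →ₚ[ℂ] ℂ) (x : A) (C : ℝ)
    (hC : ∀ y : A, ‖y‖ ≤ 1 → ‖τ (y * x)‖ ≤ C) : (τ (CFC.abs x)).re ≤ C := by
  set M := ‖τ.toPreGNS 1‖ ^ 2
  refine le_of_forall_pos_le_add fun δ hδ => ?_
  obtain ⟨u, hu, -, hxu⟩ := exists_approx_polar x (ε := δ / (M + 1)) (by positivity)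
  have e : CFC.abs x = star u * x + (CFC.abs x - star u * x) := by abel
  rw [e, map_add]
  refine (Complex.re_le_norm _).trans ((norm_add_le _ _).trans
    (add_le_add (hC _ (by rwa [norm_star])) ?_))
  refine (norm_apply_le τ _).trans ?_
  calc ‖CFC.abs x - star u * x‖ * M ≤ (δ / (M + 1)) * M :=
        mul_le_mul_of_nonneg_right hxu (by positivity)
    _ = δ * (M / (M + 1)) := by ring
    _ ≤ δ * 1 := by
        apply mul_le_mul_of_nonneg_left _ hδ.le
        rw [div_le_one (by positivity)]; linarith
    _ = δ := mul_one _

/-- `x ↦ τ(|x|)` is subadditive. -/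
lemma re_apply_abs_add_le (τ : A →ₚ[ℂ] ℂ) (hτ : ∀ a b, τ (a * b) = τ (b * a)) (x y : A) :
    (τ (CFC.abs (x + y))).re ≤ (τ (CFC.abs x)).re + (τ (CFC.abs y)).re := by
  apply re_apply_abs_le
  intro z hz
  have h1 := norm_apply_mul_le τ hτ z x
  have h2 := norm_apply_mul_le τ hτ z y
  have h3 : 0 ≤ (τ (CFC.abs x)).re := (Complex.nonneg_iff.1 (τ.map_nonneg (CFC.abs_nonneg x))).1
  have h4 : 0 ≤ (τ (CFC.abs y)).re := (Complex.nonneg_iff.1 (τ.map_nonneg (CFC.abs_nonneg y))).1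
  rw [mul_add, map_add]
  refine (norm_add_le _ _).trans ?_
  nlinarith

/-- `τ(|a x b|) ≤ ‖a‖ ‖b‖ τ(|x|)`. -/
lemma re_apply_abs_mul_le (τ : A →ₚ[ℂ] ℂ) (hτ : ∀ a b, τ (a * b) = τ (b * a)) (a x b : A) :
    (τ (CFC.abs (a * x * b))).re ≤ ‖a‖ * ‖b‖ * (τ (CFC.abs x)).re := by
  apply re_apply_abs_le
  intro z hz
  have h3 : 0 ≤ (τ (CFC.abs x)).re := (Complex.nonneg_iff.1 (τ.map_nonneg (CFC.abs_nonneg x))).1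
  have e : τ (z * (a * x * b)) = τ (b * z * a * x) := by
    rw [← mul_assoc, hτ]; simp only [mul_assoc]
  rw [e]
  refine (norm_apply_mul_le τ hτ _ _).trans (mul_le_mul_of_nonneg_right ?_ h3)
  calc ‖b * z * a‖ ≤ ‖b‖ * ‖z‖ * ‖a‖ :=
        (norm_mul_le _ _).trans (mul_le_mul_of_nonneg_right (norm_mul_le _ _) (norm_nonneg _))
    _ ≤ ‖b‖ * 1 * ‖a‖ := by gcongr
    _ = ‖a‖ * ‖b‖ := by ring

end Tracial


/-! ### The noncommutative torus

The torus `ℝⁿ/(2πℤ)ⁿ` with its normalized Lebesgue measure is written as `(ℝ/ℤ)ⁿ` with its Haar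
probability measure, by means of the rescaling `x = 2π t`. -/

/-- Real antisymmetric `n × n` matrices. -/
abbrev SkewMatrix (n : ℕ) : Type := {θ : Matrix (Fin n) (Fin n) ℝ // θ.transpose = -θ}

abbrev Torus (n : ℕ) : Type := Fin n → UnitAddCircle

abbrev haar (n : ℕ) : Measure (Torus n) := Measure.pi fun _ => AddCircle.haarAddCircle

/-- The Hilbert space `L₂(𝕋ⁿ)`. -/
abbrev H (n : ℕ) : Type := Lp ℂ 2 (haar n)

/-- The bounded operators on `L₂(𝕋ⁿ)`. -/
abbrev B (n : ℕ) : Type := H n →L[ℂ] H n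

variable {n : ℕ}

/-- The point of the torus with coordinates `sᵢ` (modulo `1`). -/
def pt (s : Fin n → ℝ) : Torus n := fun i => (s i : UnitAddCircle)

lemma pt_neg (s : Fin n → ℝ) : pt (-s) = -pt s := by
  ext i; simp [pt]

lemma measurePreserving_transl (s : Torus n) :
    MeasurePreserving (fun t => t + s) (haar n) (haar n) :=
  measurePreserving_add_right _ s

/-- Translation as an isometry of `L₂(𝕋ⁿ)`: `ξ ↦ ξ(· + s)`. -/
def translIso (s : Torus n) : H n →ₗᵢ[ℂ] H n :=
  Lp.compMeasurePreservingₗᵢ ℂ (fun t => t + s) (measurePreserving_transl s)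

lemma coeFn_translIso (s : Torus n) (ξ : H n) :
    translIso s ξ =ᵐ[haar n] fun t => ξ (t + s) :=
  Lp.coeFn_compMeasurePreserving ξ (measurePreserving_transl s)

lemma translIso_translIso (s r : Torus n) (ξ : H n) :
    translIso s (translIso r ξ) = translIso (s + r) ξ := by
  apply Lp.ext
  have h1 := coeFn_translIso s (translIso r ξ)
  have h2 := (measurePreserving_transl s).quasiMeasurePreserving.ae (coeFn_translIso r ξ)
  have h3 := coeFn_translIso (s + r) ξ
  filter_upwards [h1, h2, h3] with t h1 h2 h3
  rw [h1, h2, h3, add_assoc]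

lemma translIso_zero (ξ : H n) : translIso 0 ξ = ξ := by
  apply Lp.ext
  filter_upwards [coeFn_translIso 0 ξ] with t h
  simpa using h

/-- Translation as a unitary operator on `L₂(𝕋ⁿ)`: `ξ ↦ ξ(· + s)`. -/
def transl (s : Torus n) : unitary (B n) :=
  Unitary.linearIsometryEquiv.symm
    { (translIso s).toLinearMap with
      invFun := translIso (-s)
      left_inv := fun ξ => by
        change translIso (-s) (translIso s ξ) = ξ
        rw [translIso_translIso, neg_add_cancel, translIso_zero]
      right_inv := fun ξ => by
        change translIso s (translIso (-s) ξ) = ξ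
        rw [translIso_translIso, add_neg_cancel, translIso_zero]
      norm_map' := (translIso s).norm_map }

lemma coeFn_transl (s : Torus n) (ξ : H n) :
    (transl s : B n) ξ =ᵐ[haar n] fun t => ξ (t + s) := coeFn_translIso s ξ

/-- The exponential `t ↦ exp(2πi k·t)` as an element of `L_∞(𝕋ⁿ)`. -/
def expLp (k : Fin n → ℤ) : Lp ℂ ∞ (haar n) :=
  ContinuousMap.toLp (E := ℂ) ∞ (haar n) ℂ (UnitAddTorus.mFourier k)

lemma coeFn_expLp (k : Fin n → ℤ) : expLp k =ᵐ[haar n] UnitAddTorus.mFourier k :=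
  ContinuousMap.coeFn_toLp (haar n) _

lemma norm_mFourier_apply (k : Fin n → ℤ) (t : Torus n) : ‖UnitAddTorus.mFourier k t‖ = 1 := by
  simp [UnitAddTorus.mFourier, fourier_apply, Circle.norm_coe]

lemma mFourier_apply_add (k : Fin n → ℤ) (t s : Torus n) :
    UnitAddTorus.mFourier k (t + s) = UnitAddTorus.mFourier k t * UnitAddTorus.mFourier k s := by
  simp [UnitAddTorus.mFourier, fourier_apply, smul_add, AddCircle.toCircle_add,
    Finset.prod_mul_distrib]

lemma coeFn_expLp_smul (k : Fin n → ℤ) (ξ : H n) :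
    ((expLp k • ξ : H n) : Torus n → ℂ) =ᵐ[haar n] fun t => UnitAddTorus.mFourier k t * ξ t := by
  filter_upwards [Lp.coeFn_lpSMul (r := 2) (expLp k) ξ, coeFn_expLp k] with t h1 h2
  rw [h1, Pi.smul_apply', h2, smul_eq_mul]

lemma expLp_smul_smul (k l : Fin n → ℤ) (ξ : H n) :
    (expLp k • (expLp l • ξ : H n) : H n) = (expLp (k + l) • ξ : H n) := by
  apply Lp.ext
  filter_upwards [coeFn_expLp_smul k (expLp l • ξ : H n), coeFn_expLp_smul l ξ,
    coeFn_expLp_smul (k + l) ξ] with t h1 h2 h3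
  rw [h1, h2, h3, UnitAddTorus.mFourier_add, mul_assoc]

lemma expLp_zero_smul (ξ : H n) : (expLp (0 : Fin n → ℤ) • ξ : H n) = ξ := by
  apply Lp.ext
  filter_upwards [coeFn_expLp_smul 0 ξ] with t h
  rw [h, UnitAddTorus.mFourier_zero]; simp

lemma norm_expLp_smul (k : Fin n → ℤ) (ξ : H n) : ‖(expLp k • ξ : H n)‖ = ‖ξ‖ := by
  rw [Lp.norm_def, Lp.norm_def]
  congr 1
  apply eLpNorm_congr_norm_ae
  filter_upwards [coeFn_expLp_smul k ξ] with t h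
  rw [h, norm_mul, norm_mFourier_apply, one_mul]

/-- Multiplication by `exp(2πi k·t)` as a unitary operator on `L₂(𝕋ⁿ)`. -/
def mulExp (k : Fin n → ℤ) : unitary (B n) :=
  Unitary.linearIsometryEquiv.symm
    { toFun := fun ξ => (expLp k • ξ : H n)
      map_add' := fun ξ η => Lp.add_smul _ _ _
      map_smul' := fun c ξ => (Lp.smul_comm c (expLp k) ξ).symm
      invFun := fun ξ => (expLp (-k) • ξ : H n)
      left_inv := fun ξ => by
        change (expLp (-k) • (expLp k • ξ : H n) : H n) = ξ
        rw [expLp_smul_smul, neg_add_cancel, expLp_zero_smul]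
      right_inv := fun ξ => by
        change (expLp k • (expLp (-k) • ξ : H n) : H n) = ξ
        rw [expLp_smul_smul, add_neg_cancel, expLp_zero_smul]
      norm_map' := norm_expLp_smul k }

lemma coeFn_mulExp (k : Fin n → ℤ) (ξ : H n) :
    (mulExp k : B n) ξ =ᵐ[haar n] fun t => UnitAddTorus.mFourier k t * ξ t := by
  exact coeFn_expLp_smul k ξ

/-- The unitary `U_j`, `(U_j ξ)(x) = exp(i x_j) ξ(x + π θ_j)` with `θ_j` the `j`-th column of `θ`;
in the coordinate `t = x / 2π` this is `exp(2πi t_j) ξ(t + θ_j / 2)`. -/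
def gen (θ : SkewMatrix n) (j : Fin n) : unitary (B n) :=
  mulExp (Pi.single j 1) * transl (pt fun i => θ.1 i j / 2)

lemma coeFn_mulExp_transl (k : Fin n → ℤ) (s : Torus n) (ξ : H n) :
    ((mulExp k * transl s : unitary (B n)) : B n) ξ =ᵐ[haar n]
      fun t => UnitAddTorus.mFourier k t * ξ (t + s) := by
  filter_upwards [coeFn_mulExp k ((transl s : B n) ξ), coeFn_transl s ξ] with t h1 h2
  rw [← h2]; exact h1

lemma coeFn_gen (θ : SkewMatrix n) (j : Fin n) (ξ : H n) :
    (gen θ j : B n) ξ =ᵐ[haar n]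
      fun t => fourier 1 (t j) * ξ (t + pt fun i => θ.1 i j / 2) := by
  filter_upwards [coeFn_mulExp_transl (Pi.single j 1) (pt fun i => θ.1 i j / 2) ξ] with t h
  rw [gen, h, UnitAddTorus.mFourier_single]

/-- The constant function `1`. -/
def oneH (n : ℕ) : H n := Lp.const 2 (haar n) (1 : ℂ)

lemma coeFn_oneH : oneH n =ᵐ[haar n] fun _ => (1 : ℂ) := Lp.coeFn_const _ _ _

/-! The operators `R_j`, `(R_j ξ)(x) = exp(i x_j) ξ(x - π θ_j)`, commute with all `U_k` and agree
with `U_j` on the constant function `1`. They are used to prove that `τ` is tracial. -/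


def genR (θ : SkewMatrix n) (j : Fin n) : unitary (B n) :=
  mulExp (Pi.single j 1) * transl (pt fun i => -θ.1 i j / 2)

lemma skew_apply (θ : SkewMatrix n) (i j : Fin n) : θ.1 i j = -θ.1 j i := by
  have := congrFun (congrFun θ.2 j) i
  simpa using this

lemma skew_diag (θ : SkewMatrix n) (j : Fin n) : θ.1 j j = 0 := by
  have := skew_apply θ j j
  linarith

lemma mul_comm_of_phase {k l : Fin n → ℤ} {s r : Torus n}
    (h : UnitAddTorus.mFourier l s = UnitAddTorus.mFourier k r) :
    (mulExp k * transl s : unitary (B n)) * (mulExp l * transl r) =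
      (mulExp l * transl r) * (mulExp k * transl s) := by
  have key : ∀ (k l : Fin n → ℤ) (s r : Torus n) (ξ : H n),
      ((mulExp k * transl s : unitary (B n)) : B n)
        (((mulExp l * transl r : unitary (B n)) : B n) ξ) =ᵐ[haar n] fun t =>
        UnitAddTorus.mFourier k t * (UnitAddTorus.mFourier l (t + s) * ξ (t + s + r)) := by
    intro k l s r ξ
    filter_upwards [coeFn_mulExp_transl k s (((mulExp l * transl r : unitary (B n)) : B n) ξ),
      (measurePreserving_transl s).quasiMeasurePreserving.ae (coeFn_mulExp_transl l r ξ)]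
      with t h1 h2
    rw [h1, h2]
  apply Subtype.ext
  apply ContinuousLinearMap.ext
  intro ξ
  apply Lp.ext
  refine (key k l s r ξ).trans (Filter.EventuallyEq.trans ?_ (key l k r s ξ).symm)
  filter_upwards with t
  rw [mFourier_apply_add, mFourier_apply_add, h, add_right_comm]
  ring

lemma genR_comm_gen (θ : SkewMatrix n) (i j : Fin n) :
    Commute (genR θ i) (gen θ j) := by
  apply mul_comm_of_phase
  rw [UnitAddTorus.mFourier_single, UnitAddTorus.mFourier_single]
  congr 1
  simp only [pt]
  rw [skew_apply θ j i, neg_neg]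

lemma transl_oneH (s : Torus n) : (transl s : B n) (oneH n) = oneH n := by
  apply Lp.ext
  filter_upwards [(measurePreserving_transl s).quasiMeasurePreserving.ae (coeFn_oneH (n := n)),
    coeFn_transl s (oneH n), coeFn_oneH (n := n)] with t h1 h2 h3
  rw [h2, h1, h3]

lemma genR_oneH (θ : SkewMatrix n) (j : Fin n) :
    (genR θ j : B n) (oneH n) = (gen θ j : B n) (oneH n) := by
  change (mulExp (Pi.single j 1) : B n)
      ((transl (pt fun i => -θ.1 i j / 2) : B n) (oneH n)) =
    (mulExp (Pi.single j 1) : B n) ((transl (pt fun i => θ.1 i j / 2) : B n) (oneH n))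
  rw [transl_oneH, transl_oneH]

lemma star_mulExp_transl_oneH (j : Fin n) (s : Torus n) (hs : s j = 0) :
    (star ((mulExp (Pi.single j 1) * transl s : unitary (B n)) : B n)) (oneH n) =
      (mulExp (-Pi.single j 1) : B n) (oneH n) := by
  set G : unitary (B n) := mulExp (Pi.single j 1) * transl s with hG
  have hw : (G : B n) ((mulExp (-Pi.single j 1) : B n) (oneH n)) = oneH n := by
    apply Lp.ext
    filter_upwards [coeFn_mulExp_transl (Pi.single j 1) s
        ((mulExp (-Pi.single j 1) : B n) (oneH n)),
      (measurePreserving_transl s).quasiMeasurePreserving.ae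
        (coeFn_mulExp (-Pi.single j 1) (oneH n)),
      (measurePreserving_transl s).quasiMeasurePreserving.ae (coeFn_oneH (n := n)),
      coeFn_oneH (n := n)] with t h1 h2 h3 h4
    rw [h1, h2, h3, h4, mul_one, mFourier_apply_add, ← mul_assoc, ← UnitAddTorus.mFourier_add,
      UnitAddTorus.mFourier_neg, UnitAddTorus.mFourier_single, hs, add_neg_cancel,
      UnitAddTorus.mFourier_zero]
    simp
  have h2 : star (G : B n) * (G : B n) = 1 := Unitary.coe_star_mul_self G
  calc (star (G : B n)) (oneH n)
      = (star (G : B n)) ((G : B n) ((mulExp (-Pi.single j 1) : B n) (oneH n))) := by rw [hw]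
    _ = (star (G : B n) * (G : B n)) ((mulExp (-Pi.single j 1) : B n) (oneH n)) := rfl
    _ = _ := by rw [h2]; rfl

lemma star_genR_oneH (θ : SkewMatrix n) (j : Fin n) :
    (star (genR θ j : B n)) (oneH n) = (star (gen θ j : B n)) (oneH n) := by
  rw [genR, gen, star_mulExp_transl_oneH, star_mulExp_transl_oneH] <;>
    simp [pt, skew_diag]

/-- The C⋆-algebra `C(𝕋ⁿ_θ)`, as the closed `*`-subalgebra of the bounded operators on `L₂(𝕋ⁿ)`
generated by `U_1, …, U_n`. -/
def CTorusSub (θ : SkewMatrix n) : StarSubalgebra ℂ (B n) :=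
  (StarAlgebra.adjoin ℂ (Set.range fun j => (gen θ j : B n))).topologicalClosure

/-- The state `τ(T) = ⟨T 1, 1⟩` on the bounded operators on `L₂(𝕋ⁿ)`. -/
def tauB (T : B n) : ℂ := ⟪oneH n, T (oneH n)⟫_ℂ

lemma continuous_tauB : Continuous (tauB : B n → ℂ) := by
  unfold tauB; fun_prop

lemma tauB_star (T : B n) : tauB (star T) = star (tauB T) := by
  rw [tauB, tauB, ContinuousLinearMap.star_eq_adjoint, ContinuousLinearMap.adjoint_inner_right]
  exact (inner_conj_symm _ _).symm

lemma genR_comm (θ : SkewMatrix n) (j : Fin n) {a : B n} (ha : a ∈ CTorusSub θ) :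
    (genR θ j : B n) * a = a * (genR θ j : B n) := by
  have h : CTorusSub θ ≤ StarSubalgebra.centralizer ℂ {(genR θ j : B n)} := by
    apply StarSubalgebra.topologicalClosure_minimal
    · apply StarAlgebra.adjoin_le
      rintro _ ⟨i, rfl⟩
      rw [SetLike.mem_coe, StarSubalgebra.mem_centralizer_iff]
      rintro _ rfl
      have h1 := genR_comm_gen θ j i
      have h2 : Commute (star (genR θ j)) (gen θ i) := h1.inv_left
      exact ⟨congrArg Subtype.val h1.eq, congrArg Subtype.val h2.eq⟩
    · exact Set.isClosed_centralizer _
  exact ((StarSubalgebra.mem_centralizer_iff ℂ).1 (h ha) _ rfl).1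

lemma tauB_mul_comm (θ : SkewMatrix n) {a b : B n} (ha : a ∈ CTorusSub θ)
    (hb : b ∈ CTorusSub θ) : tauB (a * b) = tauB (b * a) := by
  have hgen : ∀ b ∈ StarAlgebra.adjoin ℂ (Set.range fun j => (gen θ j : B n)),
      ∀ a ∈ CTorusSub θ, tauB (a * b) = tauB (b * a) := by
    intro b hb
    have hsub : ∀ c ∈ StarAlgebra.adjoin ℂ (Set.range fun j => (gen θ j : B n)),
      c ∈ CTorusSub θ := fun c hc => StarSubalgebra.le_topologicalClosure _ hc
    induction hb using StarAlgebra.adjoin_induction with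
    | mem x hx =>
      obtain ⟨j, rfl⟩ := hx
      intro a ha
      have h1 : tauB (a * (gen θ j : B n)) = tauB ((genR θ j : B n) * a) := by
        rw [genR_comm θ j ha]
        change ⟪oneH n, a ((gen θ j : B n) (oneH n))⟫_ℂ =
          ⟪oneH n, a ((genR θ j : B n) (oneH n))⟫_ℂ
        rw [genR_oneH]
      have h2 : ∀ G : B n, tauB (G * a) = ⟪star G (oneH n), a (oneH n)⟫_ℂ := by
        intro G
        rw [ContinuousLinearMap.star_eq_adjoint, ContinuousLinearMap.adjoint_inner_left]
        rfl
      rw [h1, h2, h2, star_genR_oneH]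
    | algebraMap r =>
      intro a _
      rw [Algebra.commutes]
    | add x y hx hy ihx ihy =>
      intro a ha
      have hadd : ∀ S T : B n, tauB (S + T) = tauB S + tauB T := by
        intro S T; simp [tauB, inner_add_right]
      rw [mul_add, add_mul, hadd, hadd, ihx a ha, ihy a ha]
    | mul x y hx hy ihx ihy =>
      intro a ha
      rw [← mul_assoc, ihy _ (mul_mem ha (hsub _ hx)), ← mul_assoc,
        ihx _ (mul_mem (hsub _ hy) ha), mul_assoc]
    | star x hx ihx =>
      intro a ha
      have := ihx (star a) (star_mem ha)
      have h2 := congrArg star this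
      rw [← tauB_star, ← tauB_star] at h2
      simpa using h2.symm
  have hcl : closure (StarAlgebra.adjoin ℂ (Set.range fun j => (gen θ j : B n)) : Set (B n)) ⊆
      {b | tauB (a * b) = tauB (b * a)} := by
    apply closure_minimal (fun b hb => hgen b hb a ha)
    exact isClosed_eq (continuous_tauB.comp (by fun_prop)) (continuous_tauB.comp (by fun_prop))
  exact hcl hb

/-- The C⋆-algebra `C(𝕋ⁿ_θ)`. -/
def CTorus (θ : SkewMatrix n) : Type := CTorusSub θ

instance (θ : SkewMatrix n) : CStarAlgebra (CTorus θ) :=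
  haveI : IsClosed (CTorusSub θ : Set (B n)) := StarSubalgebra.isClosed_topologicalClosure _
  inferInstanceAs (CStarAlgebra (CTorusSub θ))

instance (θ : SkewMatrix n) : PartialOrder (CTorus θ) := CStarAlgebra.spectralOrder _

instance (θ : SkewMatrix n) : StarOrderedRing (CTorus θ) := CStarAlgebra.spectralOrderedRing _

/-- The inclusion of `C(𝕋ⁿ_θ)` into the bounded operators on `L₂(𝕋ⁿ)`. -/
def toB {θ : SkewMatrix n} : CTorus θ →⋆ₐ[ℂ] B n := (CTorusSub θ).subtype

lemma norm_toB {θ : SkewMatrix n} (a : CTorus θ) : ‖toB a‖ = ‖a‖ := rfl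

/-- The trace `τ` on `C(𝕋ⁿ_θ)`. -/
def tau (θ : SkewMatrix n) : CTorus θ →ₚ[ℂ] ℂ :=
  PositiveLinearMap.mk₀
    { toFun := fun a => tauB (toB a)
      map_add' := fun a b => by simp [tauB, inner_add_right]
      map_smul' := fun c a => by simp [tauB, inner_smul_right] } <| by
    intro a ha
    obtain ⟨b, rfl⟩ := CStarAlgebra.nonneg_iff_eq_star_mul_self.1 ha
    change 0 ≤ tauB (toB (star b * b))
    have : tauB (toB (star b * b)) = ⟪toB b (oneH n), toB b (oneH n)⟫_ℂ := by
      rw [map_mul, map_star, ← ContinuousLinearMap.adjoint_inner_right]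
      rfl
    rw [this, inner_self_eq_norm_sq_to_K]
    rw [← RCLike.ofReal_pow]
    exact RCLike.ofReal_nonneg.2 (sq_nonneg _)

lemma tau_apply (θ : SkewMatrix n) (a : CTorus θ) :
    tau θ a = ⟪oneH n, toB a (oneH n)⟫_ℂ := rfl

lemma tau_mul_comm (θ : SkewMatrix n) (a b : CTorus θ) : tau θ (a * b) = tau θ (b * a) := by
  change tauB (toB (a * b)) = tauB (toB (b * a))
  rw [map_mul, map_mul]
  exact tauB_mul_comm θ a.2 b.2

/-- The generators `U_j` as unitaries of `C(𝕋ⁿ_θ)`. -/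
def U (θ : SkewMatrix n) (j : Fin n) : unitary (CTorus θ) :=
  ⟨⟨(gen θ j : B n), StarSubalgebra.le_topologicalClosure _
      (StarAlgebra.subset_adjoin ℂ _ ⟨j, rfl⟩)⟩,
    Unitary.mem_iff.2 ⟨Subtype.ext (Unitary.coe_star_mul_self (gen θ j)),
      Subtype.ext (Unitary.coe_mul_star_self (gen θ j))⟩⟩

/-- `U^k = U_1^{k_1} ⋯ U_n^{k_n}`. -/
def Upow (θ : SkewMatrix n) (k : Fin n → ℤ) : unitary (CTorus θ) :=
  (List.ofFn fun j => U θ j ^ k j).prod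

/-! ### The smooth algebra -/

/-- `α_s(T) = V_s T V_s⁻¹`, where `(V_s ξ)(x) = ξ(x + s)`; in the coordinate `t = x / 2π`, `V_s` is
the translation by `s / 2π`. On `C(𝕋ⁿ_θ)` this is the action `α_s(U^k) = exp(i s·k) U^k`. -/
def alpha (s : EuclideanSpace ℝ (Fin n)) (T : B n) : B n :=
  (transl (pt fun i => s i / (2 * Real.pi)) : B n) * T *
    star (transl (pt fun i => s i / (2 * Real.pi)) : B n)

/-- `u` belongs to `C^∞(𝕋ⁿ_θ)`. -/
def IsSmooth {θ : SkewMatrix n} (u : CTorus θ) : Prop :=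
  ContDiff ℝ (⊤ : ℕ∞) fun s : EuclideanSpace ℝ (Fin n) => alpha s (toB u)

/-- `δ_j = (1/i) ∂_{s_j} α_s(·)|_{s = 0}`. -/
def delta (j : Fin n) (T : B n) : B n :=
  (-Complex.I) • lineDeriv ℝ (fun s : EuclideanSpace ℝ (Fin n) => alpha s T) 0
    (EuclideanSpace.single j 1)

/-- `D^β v = D_1^{β_1} ⋯ D_n^{β_n} v`. -/
def multiPow {X : Type*} (D : Fin n → X → X) (β : Fin n → ℕ) (v : X) : X :=
  (List.finRange n).foldr (fun j w => (D j)^[β j] w) v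

/-- The partial derivative `∂_{ξ_j}` of operator-valued functions on `ℝⁿ`. -/
def partialXi (j : Fin n) (f : EuclideanSpace ℝ (Fin n) → B n) :
    EuclideanSpace ℝ (Fin n) → B n :=
  fun ξ => lineDeriv ℝ f ξ (EuclideanSpace.single j 1)

/-! ### Symbols and pseudodifferential operators -/

/-- The class `𝕊^m(𝕋ⁿ_θ × ℝⁿ)` of standard symbols of order `m`. The topology of `C^∞(𝕋ⁿ_θ)` is
the one induced by the maps `δ^α : C^∞(𝕋ⁿ_θ) → C(𝕋ⁿ_θ)`, which embed it as a closed subspace of a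
product of Banach spaces; hence `ρ` is a `C^∞`-map to `C^∞(𝕋ⁿ_θ)` iff every `δ^α ρ` is `C^∞` as a
map to a Banach space. -/
structure IsSymbol {θ : SkewMatrix n} (m : ℝ) (ρ : EuclideanSpace ℝ (Fin n) → CTorus θ) :
    Prop where
  isSmooth : ∀ ξ, IsSmooth (ρ ξ)
  contDiff : ∀ α : Fin n → ℕ, ContDiff ℝ (⊤ : ℕ∞) fun ξ => multiPow delta α (toB (ρ ξ))
  bound : ∀ α β : Fin n → ℕ, ∃ C : ℝ, ∀ ξ : EuclideanSpace ℝ (Fin n),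
    ‖multiPow delta α (multiPow partialXi β (fun η => toB (ρ η)) ξ)‖ ≤
      C * (1 + ‖ξ‖) ^ (m - ∑ j, (β j : ℝ))

/-- The point `k ∈ ℤⁿ ⊆ ℝⁿ`. -/
def intPt (k : Fin n → ℤ) : EuclideanSpace ℝ (Fin n) := WithLp.toLp 2 fun j => (k j : ℝ)

/-- The Fourier coefficient `u_k = ⟨u, U^k⟩ = τ(u (U^k)^*)`. -/
def fourierCoeffNC {θ : SkewMatrix n} (u : CTorus θ) (k : Fin n → ℤ) : ℂ :=
  tau θ (u * star (Upow θ k : CTorus θ))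

/-- The pseudodifferential operator `P_ρ u = ∑_k u_k ρ(k) U^k`, for `u ∈ C^∞(𝕋ⁿ_θ)`. -/
def psiDO {θ : SkewMatrix n} (ρ : EuclideanSpace ℝ (Fin n) → CTorus θ) (u : CTorus θ) :
    CTorus θ :=
  ∑' k : Fin n → ℤ, fourierCoeffNC u k • (ρ (intPt k) * (Upow θ k : CTorus θ))

/-! ### `L₂(𝕋ⁿ_θ)` -/

/-- The Hilbert space `L₂(𝕋ⁿ_θ)`: the completion of `C(𝕋ⁿ_θ)` with respect to the inner product
`⟨u, v⟩ = τ(u v^*) = τ(v^* u)`, which is `⟪v, u⟫_ℂ` in Mathlib's convention. -/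
abbrev L2 (θ : SkewMatrix n) : Type := (tau θ).GNS

/-- The inclusion `C(𝕋ⁿ_θ) → L₂(𝕋ⁿ_θ)`. -/
def toL2 {θ : SkewMatrix n} (u : CTorus θ) : L2 θ := ((tau θ).toPreGNS u : (tau θ).PreGNS)

lemma inner_toL2 {θ : SkewMatrix n} (u v : CTorus θ) :
    ⟪toL2 v, toL2 u⟫_ℂ = tau θ (u * star v) := by
  rw [toL2, toL2, UniformSpace.Completion.inner_coe, PositiveLinearMap.preGNS_inner_def]
  exact tau_mul_comm θ _ _

/-- Right multiplication by `a` on `C(𝕋ⁿ_θ)` with the norm of `L₂(𝕋ⁿ_θ)`. -/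
def preMulRight {θ : SkewMatrix n} (a : CTorus θ) : (tau θ).PreGNS →L[ℂ] (tau θ).PreGNS :=
  ((tau θ).toPreGNS.toLinearMap ∘ₗ (LinearMap.mul ℂ (CTorus θ)).flip a ∘ₗ
    (tau θ).ofPreGNS.toLinearMap).mkContinuous ‖a‖ fun x =>
      norm_toPreGNS_mul_le_right (tau θ) (tau_mul_comm θ) a ((tau θ).ofPreGNS x)

/-- The product `x a ∈ L₂(𝕋ⁿ_θ)` of `x ∈ L₂(𝕋ⁿ_θ)` and `a ∈ C(𝕋ⁿ_θ)`, i.e. `λ(x) a`: the continuous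
extension in `x` of the product of `C(𝕋ⁿ_θ)`. -/
def mulL2 {θ : SkewMatrix n} (x : L2 θ) (a : CTorus θ) : L2 θ := (preMulRight a).completion x

lemma mulL2_toL2 {θ : SkewMatrix n} (x a : CTorus θ) : mulL2 (toL2 x) a = toL2 (x * a) := by
  rw [mulL2, toL2, ContinuousLinearMap.completion_apply_coe]
  rfl

/-- The continuous extension of `τ` to `L₂(𝕋ⁿ_θ)`, `τ(x) = ⟨x, 1⟩`. -/
def tauL2 {θ : SkewMatrix n} (x : L2 θ) : ℂ := ⟪toL2 1, x⟫_ℂ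

lemma tauL2_toL2 {θ : SkewMatrix n} (x : CTorus θ) : tauL2 (toL2 x) = tau θ x := by
  rw [tauL2, inner_toL2, star_one, mul_one]

/-! ### `L₁(𝕋ⁿ_θ)` -/

/-- `C(𝕋ⁿ_θ)` with the norm `‖x‖₁ = τ(|x|)`. -/
def PreL1 (θ : SkewMatrix n) : Type := CTorus θ

namespace PreL1

variable {θ : SkewMatrix n}

instance : AddCommGroup (PreL1 θ) := inferInstanceAs (AddCommGroup (CTorus θ))
instance : Module ℂ (PreL1 θ) := inferInstanceAs (Module ℂ (CTorus θ))

def of : CTorus θ ≃ₗ[ℂ] PreL1 θ := LinearEquiv.refl ℂ _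

instance : Norm (PreL1 θ) := ⟨fun x => (tau θ (CFC.abs (of.symm x))).re⟩

lemma norm_def (x : PreL1 θ) : ‖x‖ = (tau θ (CFC.abs (of.symm x))).re := rfl

instance : SeminormedAddCommGroup (PreL1 θ) :=
  SeminormedAddCommGroup.ofCore (𝕜 := ℂ)
    { norm_nonneg := fun x =>
        (Complex.nonneg_iff.1 ((tau θ).map_nonneg (CFC.abs_nonneg (of.symm x)))).1
      norm_smul := fun c x => by
        rw [norm_def, norm_def, map_smul, CFC.abs_smul, ← Complex.coe_smul, map_smul]
        simp
      norm_triangle := fun x y => by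
        rw [norm_def, norm_def, norm_def, map_add]
        exact re_apply_abs_add_le (tau θ) (tau_mul_comm θ) _ _ }

instance : NormedSpace ℂ (PreL1 θ) where
  norm_smul_le c x := by
    rw [norm_def, norm_def, map_smul, CFC.abs_smul, ← Complex.coe_smul, map_smul]
    simp

end PreL1

/-- The Banach space `L₁(𝕋ⁿ_θ)`: the completion of `C(𝕋ⁿ_θ)` with respect to `‖x‖₁ = τ(|x|)`. -/
abbrev L1 (θ : SkewMatrix n) : Type := UniformSpace.Completion (PreL1 θ)

/-- The inclusion `C(𝕋ⁿ_θ) → L₁(𝕋ⁿ_θ)`. -/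
def toL1 {θ : SkewMatrix n} (u : CTorus θ) : L1 θ := (PreL1.of u : PreL1 θ)

lemma norm_toL1 {θ : SkewMatrix n} (u : CTorus θ) : ‖toL1 u‖ = (tau θ (CFC.abs u)).re :=
  UniformSpace.Completion.norm_coe _

/-- `x ↦ a x b` on `C(𝕋ⁿ_θ)` with the norm of `L₁(𝕋ⁿ_θ)`. -/
def preMulL1 {θ : SkewMatrix n} (a b : CTorus θ) : PreL1 θ →L[ℂ] PreL1 θ :=
  (PreL1.of.toLinearMap ∘ₗ LinearMap.mulLeftRight ℂ (a, b) ∘ₗ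
    PreL1.of.symm.toLinearMap).mkContinuous (‖a‖ * ‖b‖) fun x =>
      re_apply_abs_mul_le (tau θ) (tau_mul_comm θ) a (PreL1.of.symm x) b

/-- The product `a x b ∈ L₁(𝕋ⁿ_θ)` of `x ∈ L₁(𝕋ⁿ_θ)` and `a, b ∈ C(𝕋ⁿ_θ)`: the continuous
extension in `x` of the product of `C(𝕋ⁿ_θ)`. -/
def mulL1 {θ : SkewMatrix n} (a : CTorus θ) (x : L1 θ) (b : CTorus θ) : L1 θ :=
  (preMulL1 a b).completion x

lemma mulL1_toL1 {θ : SkewMatrix n} (a x b : CTorus θ) :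
    mulL1 a (toL1 x) b = toL1 (a * x * b) := by
  rw [mulL1, toL1, ContinuousLinearMap.completion_apply_coe]
  rfl

def preTauL1 (θ : SkewMatrix n) : PreL1 θ →L[ℂ] ℂ :=
  ((tau θ).toLinearMap ∘ₗ PreL1.of.symm.toLinearMap).mkContinuous ‖(1 : CTorus θ)‖ fun x => by
    have := norm_apply_mul_le (tau θ) (tau_mul_comm θ) 1 (PreL1.of.symm x)
    rw [one_mul] at this
    exact this

/-- The continuous extension of `τ` to `L₁(𝕋ⁿ_θ)`. -/
def tauL1 {θ : SkewMatrix n} (x : L1 θ) : ℂ :=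
  UniformSpace.Completion.extension (preTauL1 θ) x

lemma tauL1_toL1 {θ : SkewMatrix n} (x : CTorus θ) : tauL1 (toL1 x) = tau θ x := by
  rw [tauL1, toL1, UniformSpace.Completion.extension_coe (preTauL1 θ).uniformContinuous]
  rfl

/-- For `x ∈ L₁(𝕋ⁿ_θ)`, the operator `λ(x)` from `C(𝕋ⁿ_θ)` to its antilinear dual,
`⟨λ(x) u, v⟩ = τ[v^* x u]`. -/
def lambdaL1 {θ : SkewMatrix n} (x : L1 θ) (u v : CTorus θ) : ℂ := tauL1 (mulL1 (star v) x u)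

/-! ### Trace-class operators -/

section Trace

variable {K : Type} [NormedAddCommGroup K] [InnerProductSpace ℂ K] [CompleteSpace K]

/-- `T` is trace class: `∑ ⟨|T| eᵢ, eᵢ⟩ < ∞` for every orthonormal basis, `|T| = √(T^*T)`. -/
def IsTraceClass (T : K →L[ℂ] K) : Prop :=
  ∀ (ι : Type) (e : HilbertBasis ι ℂ K), Summable fun i => ⟪e i, CFC.abs T (e i)⟫_ℂ

/-- `T` is trace class with trace `c`: `∑ ⟨T eᵢ, eᵢ⟩ = c` for every orthonormal basis. -/
def HasTrace (T : K →L[ℂ] K) (c : ℂ) : Prop :=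
  IsTraceClass T ∧ ∀ (ι : Type) (e : HilbertBasis ι ℂ K), HasSum (fun i => ⟪e i, T (e i)⟫_ℂ) c

end Trace

/-! ### The operators `λ(x) P_ρ` and `P_σ^* λ(x) P_ρ` on `L₂(𝕋ⁿ_θ)` -/

/-- `T` is a bounded extension to `L₂(𝕋ⁿ_θ)` of the operator `u ↦ λ(x) P_ρ u` on `C^∞(𝕋ⁿ_θ)`. -/
def ExtendsLambdaPsiDO {θ : SkewMatrix n} (x : L2 θ) (ρ : EuclideanSpace ℝ (Fin n) → CTorus θ)
    (T : L2 θ →L[ℂ] L2 θ) : Prop :=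
  ∀ u : CTorus θ, IsSmooth u → T (toL2 u) = mulL2 x (psiDO ρ u)

/-- `T` is a bounded extension to `L₂(𝕋ⁿ_θ)` of the operator `u ↦ P_σ^* λ(x) P_ρ u` on
`C^∞(𝕋ⁿ_θ)`, where `P_σ^*` acts on antilinear forms by duality:
`⟨P_σ^* λ(x) P_ρ u, v⟩ = ⟨λ(x) P_ρ u, P_σ v⟩`. -/
def ExtendsSandwichPsiDO {θ : SkewMatrix n} (x : L1 θ)
    (σ ρ : EuclideanSpace ℝ (Fin n) → CTorus θ) (T : L2 θ →L[ℂ] L2 θ) : Prop :=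
  ∀ u v : CTorus θ, IsSmooth u → IsSmooth v →
    ⟪toL2 v, T (toL2 u)⟫_ℂ = lambdaL1 x (psiDO ρ u) (psiDO σ v)

end NCTorus

end

open MeasureTheory
open scoped ENNReal ComplexOrder InnerProductSpace

noncomputable section

namespace NCTorus

/-! ### Sums of rank-one operators -/

/-! Both operators are norm-convergent sums of rank-one operators, and their traces are read off the
diagonal in the orthonormal basis `(U^k)`.

If `∑ ‖a_p‖ ‖b_p‖ < ∞`, then `∑ ⟨·, b_p⟩ a_p` is trace class (`hasTrace_rankOne`): in an orthonormal
basis, Cauchy–Schwarz and Bessel bound the contribution of each `p` by `‖a_p‖ ‖b_p‖`, and Fubini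
makes the trace independent of the basis. Up to a phase, `U^k` is a Weyl operator "translate, then
multiply by a character", which gives orthonormality and density of the `U^k` in L₂ (`basisL2`).
Moreover `P_ρ U^k = ρ(k) U^k`.

(1) Here `λ(x) P_ρ = ∑_k ⟨·, U^k⟩ x ρ(k) U^k`, whose terms have norm at most `‖x‖₂ ‖ρ(k)‖`; this is
summable for `m > n`. As `U^k` is unitary, the diagonal entries are `τ[x ρ(k)]`.

(2) Any `x ∈ L₁` is a sum of products `r_j s_j` with `∑ ‖r_j‖₂ ‖s_j‖₂ < ∞`; this comes from `x =
x(|x|+ε)^{-1/2} · (|x|+ε)^{1/2}` (`exists_factorization`). Hence `P_σ^* λ(x) P_ρ = ∑_j (λ(r_j^*)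
P_σ)^* (λ(s_j) P_ρ)`. The factors are Hilbert–Schmidt, with norms controlled by `‖r_j‖₂ (∑_k
‖σ(k)‖²)^{1/2}` and `‖s_j‖₂ (∑_k ‖ρ(k)‖²)^{1/2}`, finite because `2m > n`. A product of two
Hilbert–Schmidt operators is a sum of rank-one operators (`exists_rankOne_of_inner`), and these sums
add up over `j`. Cyclicity of `τ` turns the diagonal entries into `τ[x ρ(k) σ(k)^*]`.

Uniqueness holds because the `U^k` are smooth and span a dense subspace. Absolute convergence is
contained in `HasSum`, since unconditional and absolute convergence agree in ℂ. -/

lemma summable_mul_and_tsum_mul_le_sqrt {ι : Type*} {f g : ι → ℝ} (hf0 : ∀ i, 0 ≤ f i)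
    (hg0 : ∀ i, 0 ≤ g i) (hf : Summable fun i => f i ^ 2) (hg : Summable fun i => g i ^ 2) :
    Summable (fun i => f i * g i) ∧
      ∑' i, f i * g i ≤ √(∑' i, f i ^ 2) * √(∑' i, g i ^ 2) := by
  have key : ∀ s : Finset ι, ∑ i ∈ s, f i * g i ≤ √(∑' i, f i ^ 2) * √(∑' i, g i ^ 2) := by
    intro s
    refine (Real.sum_mul_le_sqrt_mul_sqrt s f g).trans ?_
    gcongr
    · exact hf.sum_le_tsum s fun i _ => sq_nonneg _
    · exact hg.sum_le_tsum s fun i _ => sq_nonneg _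
  have hnn : ∀ i, 0 ≤ f i * g i := fun i => mul_nonneg (hf0 i) (hg0 i)
  exact ⟨summable_of_sum_le hnn key, (summable_of_sum_le hnn key).tsum_le_of_sum_le key⟩

section RankOne

variable {K : Type} [NormedAddCommGroup K] [InnerProductSpace ℂ K]

/-- Cauchy–Schwarz followed by Bessel for each of the two vectors. This is the trace-norm bound for
a single rank-one operator. -/
lemma summable_norm_inner_mul {ι : Type*} {e : ι → K} (he : Orthonormal ℂ e) (a b : K) :
    Summable (fun i => ‖⟪b, e i⟫_ℂ‖ * ‖⟪e i, a⟫_ℂ‖) ∧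
      ∑' i, ‖⟪b, e i⟫_ℂ‖ * ‖⟪e i, a⟫_ℂ‖ ≤ ‖b‖ * ‖a‖ := by
  have hb := he.inner_products_summable b
  have ha := he.inner_products_summable a
  simp only [norm_inner_symm (e _) b] at hb
  obtain ⟨h1, h2⟩ := summable_mul_and_tsum_mul_le_sqrt (fun i => norm_nonneg ⟪b, e i⟫_ℂ)
    (fun i => norm_nonneg ⟪e i, a⟫_ℂ) hb ha
  refine ⟨h1, h2.trans ?_⟩
  gcongr
  · apply Real.sqrt_le_left (norm_nonneg _) |>.2
    have := he.tsum_inner_products_le b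
    simpa only [norm_inner_symm (e _) b] using this
  · exact Real.sqrt_le_left (norm_nonneg _) |>.2 (he.tsum_inner_products_le a)

/-- The columns of a Hilbert–Schmidt matrix: if `∑ ‖w_l‖² < ∞`, then the vectors
`∑_l ⟨w_l, g_p⟩ g_l` are square-summable as well, with the same sum. -/
lemma exists_transpose {ι : Type*} (g : HilbertBasis ι ℂ K) (w : ι → K)
    (hw : Summable fun l => ‖w l‖ ^ 2) :
    ∃ a : ι → K, (∀ p l, ⟪g l, a p⟫_ℂ = ⟪w l, g p⟫_ℂ) ∧
      HasSum (fun p => ‖a p‖ ^ 2) (∑' l, ‖w l‖ ^ 2) := by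
  have hpars : ∀ x : K, HasSum (fun p => ‖⟪g p, x⟫_ℂ‖ ^ 2) (‖x‖ ^ 2) := by
    intro x
    have := (Complex.hasSum_re (g.hasSum_inner_mul_inner x x))
    convert this using 1
    · ext p
      rw [← inner_conj_symm x (g p), RCLike.conj_mul]
      simp [← Complex.ofReal_pow]
    · rw [inner_self_eq_norm_sq_to_K]
      simp [← Complex.ofReal_pow]
  -- Tonelli for the squared matrix entries: by Parseval the row sums are `‖w_l‖²`, so the columns
  -- are square-summable too, and each column is the coefficient sequence of a vector.
  have hs : Summable fun q : ι × ι => ‖⟪w q.1, g q.2⟫_ℂ‖ ^ 2 := by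
    refine (summable_prod_of_nonneg fun q => by positivity).2 ⟨fun l => ?_, ?_⟩
    · simpa only [norm_inner_symm (w l)] using (hpars (w l)).summable
    · simpa only [norm_inner_symm (w _), (hpars _).tsum_eq] using hw
  have hs' : Summable fun q : ι × ι => ‖⟪w q.2, g q.1⟫_ℂ‖ ^ 2 :=
    (Equiv.prodComm ι ι).summable_iff.2 hs
  have hex : ∀ p, ∃ v : K, ∀ l, ⟪g l, v⟫_ℂ = ⟪w l, g p⟫_ℂ := by
    intro p
    have hmem : Memℓp (fun l => ⟪w l, g p⟫_ℂ) 2 := memℓp_gen (by simpa using hs'.prod_factor p)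
    refine ⟨g.repr.symm ⟨fun l => ⟪w l, g p⟫_ℂ, hmem⟩, fun l => ?_⟩
    rw [← g.repr_apply_apply, LinearIsometryEquiv.apply_symm_apply]
  choose a ha using hex
  refine ⟨a, ha, ?_⟩
  have hsum : ∑' q : ι × ι, ‖⟪w q.1, g q.2⟫_ℂ‖ ^ 2 = ∑' l, ‖w l‖ ^ 2 := by
    refine (hs.hasSum.prod_fiberwise (g := fun l => ‖w l‖ ^ 2) fun l => ?_).tsum_eq.symm
    simpa only [norm_inner_symm (w l)] using hpars (w l)
  have hs2 : HasSum (fun q : ι × ι => ‖⟪w q.2, g q.1⟫_ℂ‖ ^ 2) (∑' l, ‖w l‖ ^ 2) := by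
    rw [← hsum]
    exact (Equiv.prodComm ι ι).hasSum_iff.2 hs.hasSum
  refine hs2.prod_fiberwise fun p => ?_
  simpa only [ha] using hpars (a p)

/-- The operator with matrix `⟨w_l, z_k⟩`, for square-summable `w` and `z`, as a norm-convergent
sum of rank-one operators. -/
lemma exists_rankOne_of_inner {ι : Type*} (g : HilbertBasis ι ℂ K) (w z : ι → K)
    (hw : Summable fun l => ‖w l‖ ^ 2) (hz : Summable fun l => ‖z l‖ ^ 2) :
    ∃ a b : ι → K, Summable (fun p => ‖a p‖ * ‖b p‖) ∧
      ∑' p, ‖a p‖ * ‖b p‖ ≤ √(∑' l, ‖w l‖ ^ 2) * √(∑' l, ‖z l‖ ^ 2) ∧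
      ∀ l k, HasSum (fun p => ⟪b p, g k⟫_ℂ * ⟪g l, a p⟫_ℂ) ⟪w l, z k⟫_ℂ := by
  obtain ⟨a, ha, ha2⟩ := exists_transpose g w hw
  obtain ⟨b, hb, hb2⟩ := exists_transpose g z hz
  obtain ⟨h1, h2⟩ := summable_mul_and_tsum_mul_le_sqrt (fun p => norm_nonneg (a p))
    (fun p => norm_nonneg (b p)) ha2.summable hb2.summable
  rw [ha2.tsum_eq, hb2.tsum_eq] at h2
  refine ⟨a, b, h1, h2, fun l k => ?_⟩
  -- With `a` and `b` the columns of the two matrices, the rank-one expansion of an entry is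
  -- Parseval's formula for `⟨w_l, z_k⟩` in the basis `g`.
  have e : (fun p => ⟪b p, g k⟫_ℂ * ⟪g l, a p⟫_ℂ) = fun p => ⟪w l, g p⟫_ℂ * ⟪g p, z k⟫_ℂ := by
    ext p
    rw [ha, ← inner_conj_symm (b p), hb, inner_conj_symm, mul_comm]
  rw [e]
  exact g.hasSum_inner_mul_inner (w l) (z k)

variable [CompleteSpace K] {J : Type*} {a b : J → K}

lemma hasSum_rankOne (h : Summable fun p => ‖a p‖ * ‖b p‖) :
    HasSum (fun p => InnerProductSpace.rankOne ℂ (a p) (b p))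
      (∑' p, InnerProductSpace.rankOne ℂ (a p) (b p)) := by
  refine (Summable.of_norm ?_).hasSum
  simpa [InnerProductSpace.norm_rankOne] using h

lemma hasSum_rankOne_apply (h : Summable fun p => ‖a p‖ * ‖b p‖) (ξ : K) :
    HasSum (fun p => ⟪b p, ξ⟫_ℂ • a p)
      ((∑' p, InnerProductSpace.rankOne ℂ (a p) (b p)) ξ) := by
  have := (hasSum_rankOne h).mapL (ContinuousLinearMap.apply ℂ K ξ)
  simpa [InnerProductSpace.rankOne_apply] using this

lemma hasSum_inner_rankOne_apply (h : Summable fun p => ‖a p‖ * ‖b p‖) (η ξ : K) :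
    HasSum (fun p => ⟪b p, ξ⟫_ℂ * ⟪η, a p⟫_ℂ)
      ⟪η, (∑' p, InnerProductSpace.rankOne ℂ (a p) (b p)) ξ⟫_ℂ := by
  have := (hasSum_rankOne_apply h ξ).mapL (innerSL ℂ η)
  simpa [inner_smul_right] using this

/-- An approximate polar decomposition `|T| ≈ u^* T` with `‖u‖ ≤ 1` reduces the diagonal of `|T|` to
sums of `⟨T e_i, u e_i⟩`. Letting the hypothesis range over all contractions `u` avoids the exact
partial isometry. -/
lemma isTraceClass_of_sum_le (T : K →L[ℂ] K) (M : ℝ)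
    (hM : ∀ (ι : Type) (e : ι → K), Orthonormal ℂ e → ∀ u : K →L[ℂ] K, ‖u‖ ≤ 1 →
      ∀ s : Finset ι, ∑ i ∈ s, ‖⟪u (e i), T (e i)⟫_ℂ‖ ≤ M) : IsTraceClass T := by
  intro ι e
  refine Summable.of_norm (summable_of_sum_le (c := M) (fun i => norm_nonneg _) fun s => ?_)
  refine le_of_forall_pos_le_add fun δ hδ => ?_
  -- The error per basis vector is chosen so that over the finite set `s` it adds up to at most `δ`.
  obtain ⟨u, hu, -, hTu⟩ := exists_approx_polar T (ε := δ / (s.card + 1)) (by positivity)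
  have hterm : ∀ i, ‖⟪e i, CFC.abs T (e i)⟫_ℂ‖ ≤
      ‖⟪u (e i), T (e i)⟫_ℂ‖ + δ / (s.card + 1) := by
    intro i
    have h1 : ⟪e i, CFC.abs T (e i)⟫_ℂ =
        ⟪u (e i), T (e i)⟫_ℂ + ⟪e i, (CFC.abs T - star u * T) (e i)⟫_ℂ := by
      have : ⟪u (e i), T (e i)⟫_ℂ = ⟪e i, (star u * T) (e i)⟫_ℂ := by
        rw [ContinuousLinearMap.star_eq_adjoint]
        exact (ContinuousLinearMap.adjoint_inner_right u _ _).symm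
      rw [this, ← inner_add_right, ← add_apply, add_sub_cancel]
    rw [h1]
    refine (norm_add_le _ _).trans (add_le_add le_rfl ((norm_inner_le_norm _ _).trans ?_))
    have h2 : ‖e i‖ = 1 := e.orthonormal.1 i
    have h3 := (CFC.abs T - star u * T).le_opNorm (e i)
    rw [h2, mul_one] at h3
    rw [h2, one_mul]
    exact h3.trans hTu
  calc ∑ i ∈ s, ‖⟪e i, CFC.abs T (e i)⟫_ℂ‖
      ≤ ∑ i ∈ s, (‖⟪u (e i), T (e i)⟫_ℂ‖ + δ / (s.card + 1)) :=
        Finset.sum_le_sum fun i _ => hterm i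
    _ = ∑ i ∈ s, ‖⟪u (e i), T (e i)⟫_ℂ‖ + δ * (s.card / (s.card + 1)) := by
        rw [Finset.sum_add_distrib, Finset.sum_const, nsmul_eq_mul]; ring
    _ ≤ M + δ * 1 := by
        refine add_le_add (hM ι e e.orthonormal u hu s) ?_
        gcongr
        rw [div_le_one (by positivity)]; linarith
    _ = M + δ := by rw [mul_one]

/-- Moving the contraction onto the vectors `a_p` through its adjoint does not increase their norms,
so each `p` contributes at most `‖a_p‖ ‖b_p‖`; only a finite sum is exchanged with the series over
`p`. -/
lemma isTraceClass_rankOne (h : Summable fun p => ‖a p‖ * ‖b p‖) :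
    IsTraceClass (∑' p, InnerProductSpace.rankOne ℂ (a p) (b p)) := by
  refine isTraceClass_of_sum_le _ (∑' p, ‖a p‖ * ‖b p‖) fun ι e he u hu s => ?_
  set v := ContinuousLinearMap.adjoint u
  have hv : ‖v‖ ≤ 1 := by simpa [v] using hu
  have hva : ∀ p, ‖v (a p)‖ ≤ ‖a p‖ := fun p =>
    (v.le_of_opNorm_le hv _).trans_eq (one_mul _)
  have hfin : ∀ p, ∑ i ∈ s, ‖⟪b p, e i⟫_ℂ‖ * ‖⟪e i, v (a p)⟫_ℂ‖ ≤ ‖a p‖ * ‖b p‖ := by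
    intro p
    obtain ⟨h1, h2⟩ := summable_norm_inner_mul he (v (a p)) (b p)
    refine (h1.sum_le_tsum s fun i _ => by positivity).trans (h2.trans ?_)
    rw [mul_comm]
    exact mul_le_mul_of_nonneg_right (hva p) (norm_nonneg _)
  have hsum : ∀ i, Summable fun p => ‖⟪b p, e i⟫_ℂ‖ * ‖⟪e i, v (a p)⟫_ℂ‖ := by
    intro i
    refine Summable.of_nonneg_of_le (fun p => by positivity) (fun p => ?_) h
    have h1 := norm_inner_le_norm (𝕜 := ℂ) (b p) (e i)
    have h2 := norm_inner_le_norm (𝕜 := ℂ) (e i) (v (a p))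
    rw [he.1 i, mul_one] at h1
    rw [he.1 i, one_mul] at h2
    rw [mul_comm ‖a p‖]
    gcongr
    exact h2.trans (hva p)
  calc ∑ i ∈ s, ‖⟪u (e i), (∑' p, InnerProductSpace.rankOne ℂ (a p) (b p)) (e i)⟫_ℂ‖
      ≤ ∑ i ∈ s, ∑' p, ‖⟪b p, e i⟫_ℂ‖ * ‖⟪e i, v (a p)⟫_ℂ‖ := by
        refine Finset.sum_le_sum fun i _ => ?_
        rw [← (hasSum_inner_rankOne_apply h (u (e i)) (e i)).tsum_eq]
        have hv' : ∀ p, ⟪u (e i), a p⟫_ℂ = ⟪e i, v (a p)⟫_ℂ := fun p =>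
          (ContinuousLinearMap.adjoint_inner_right u _ _).symm
        simp only [hv']
        simpa only [norm_mul] using norm_tsum_le_tsum_norm
          (f := fun p => ⟪b p, e i⟫_ℂ * ⟪e i, v (a p)⟫_ℂ) (by simpa only [norm_mul] using hsum i)
    _ = ∑' p, ∑ i ∈ s, ‖⟪b p, e i⟫_ℂ‖ * ‖⟪e i, v (a p)⟫_ℂ‖ :=
        (Summable.tsum_finsetSum fun i _ => hsum i).symm
    _ ≤ ∑' p, ‖a p‖ * ‖b p‖ := by
        refine Summable.tsum_le_tsum hfin (summable_sum fun i _ => hsum i) h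

/-- A norm-convergent sum of rank-one operators is trace class. -/
theorem hasTrace_rankOne (h : Summable fun p => ‖a p‖ * ‖b p‖) :
    HasTrace (∑' p, InnerProductSpace.rankOne ℂ (a p) (b p)) (∑' p, ⟪b p, a p⟫_ℂ) := by
  refine ⟨isTraceClass_rankOne h, fun ι e => ?_⟩
  -- Fubini: this double series sums to `⟨b_p, a_p⟩` along the basis index and to the diagonal
  -- entries of the operator along `p`.
  have hs : Summable fun q : J × ι => ⟪b q.1, e q.2⟫_ℂ * ⟪e q.2, a q.1⟫_ℂ := by
    refine Summable.of_norm ?_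
    simp only [norm_mul]
    refine (summable_prod_of_nonneg fun q => by positivity).2
      ⟨fun p => (summable_norm_inner_mul e.orthonormal (a p) (b p)).1, ?_⟩
    refine Summable.of_nonneg_of_le (fun p => tsum_nonneg fun i => by positivity) (fun p => ?_) h
    rw [mul_comm]
    exact (summable_norm_inner_mul e.orthonormal (a p) (b p)).2
  have h1 := hs.hasSum.prod_fiberwise fun p => e.hasSum_inner_mul_inner (b p) (a p)
  rw [h1.tsum_eq]
  refine HasSum.prod_fiberwise (f := fun q : ι × J => ⟪b q.2, e q.1⟫_ℂ * ⟪e q.1, a q.2⟫_ℂ)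
    ((Equiv.prodComm ι J).hasSum_iff.2 hs.hasSum) fun i => ?_
  exact hasSum_inner_rankOne_apply h (e i) (e i)

end RankOne

/-! ### Weyl operators -/

section Weyl

variable {n : ℕ}

/-- The operator `ξ ↦ exp(2πi k·t) ξ(t + s)`. -/
def weyl (k : Fin n → ℤ) (s : Torus n) : unitary (B n) := mulExp k * transl s

/-- Translating the character `l` by `s` multiplies it by its value at `s`; that value is the phase.
-/
lemma weyl_mul (k l : Fin n → ℤ) (s r : Torus n) :
    (weyl k s : B n) * (weyl l r : B n) =
      UnitAddTorus.mFourier l s • (weyl (k + l) (s + r) : B n) := by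
  apply ContinuousLinearMap.ext
  intro ξ
  apply Lp.ext
  have h0 : ((UnitAddTorus.mFourier l s • (weyl (k + l) (s + r) : B n)) ξ : H n) =
    UnitAddTorus.mFourier l s • (weyl (k + l) (s + r) : B n) ξ := rfl
  rw [h0]
  filter_upwards [coeFn_mulExp_transl k s ((weyl l r : B n) ξ),
    (measurePreserving_transl s).quasiMeasurePreserving.ae (coeFn_mulExp_transl l r ξ),
    coeFn_mulExp_transl (k + l) (s + r) ξ,
    Lp.coeFn_smul (UnitAddTorus.mFourier l s) ((weyl (k + l) (s + r) : B n) ξ)] with t h1 h2 h3 h4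
  change ((weyl k s : B n) ((weyl l r : B n) ξ)) t = _
  rw [h4, Pi.smul_apply, smul_eq_mul]
  refine h1.trans ?_
  rw [weyl, h2, weyl, h3, mFourier_apply_add, UnitAddTorus.mFourier_add, add_assoc]
  ring

lemma weyl_zero : (weyl (0 : Fin n → ℤ) 0 : unitary (B n)) = 1 := by
  apply Subtype.ext
  apply ContinuousLinearMap.ext
  intro ξ
  apply Lp.ext
  filter_upwards [coeFn_mulExp_transl 0 0 ξ] with t h
  refine h.trans ?_
  rw [UnitAddTorus.mFourier_zero, add_zero, ContinuousMap.one_apply, one_mul]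
  rfl

lemma transl_eq_weyl (s : Torus n) : (transl s : B n) = weyl 0 s := by
  apply ContinuousLinearMap.ext
  intro ξ
  apply Lp.ext
  filter_upwards [coeFn_mulExp_transl 0 s ξ, coeFn_transl s ξ] with t h h'
  rw [h']
  refine Eq.trans ?_ h.symm
  rw [UnitAddTorus.mFourier_zero, ContinuousMap.one_apply, one_mul]

lemma mFourier_apply_ne_zero (k : Fin n → ℤ) (s : Torus n) : UnitAddTorus.mFourier k s ≠ 0 :=
  norm_ne_zero_iff.1 (by rw [norm_mFourier_apply]; exact one_ne_zero)

lemma star_weyl (k : Fin n → ℤ) (s : Torus n) :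
    star (weyl k s : B n) = (UnitAddTorus.mFourier (-k) s)⁻¹ • (weyl (-k) (-s) : B n) := by
  have h := weyl_mul k (-k) s (-s)
  rw [add_neg_cancel, add_neg_cancel, weyl_zero, OneMemClass.coe_one] at h
  have h2 := congrArg (fun T => star (weyl k s : B n) * T) h
  simp only [← mul_assoc, Unitary.coe_star_mul_self, one_mul, mul_smul_comm, mul_one] at h2
  rw [h2, smul_smul, inv_mul_cancel₀ (mFourier_apply_ne_zero _ _), one_smul]

lemma star_transl (s : Torus n) : star (transl s : B n) = weyl 0 (-s) := by
  rw [transl_eq_weyl, star_weyl, neg_zero, UnitAddTorus.mFourier_zero]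
  simp

lemma alpha_weyl (s : EuclideanSpace ℝ (Fin n)) (k : Fin n → ℤ) (r : Torus n) :
    alpha s (weyl k r : B n) =
      UnitAddTorus.mFourier k (pt fun i => s i / (2 * Real.pi)) • (weyl k r : B n) := by
  rw [alpha, star_transl, transl_eq_weyl, weyl_mul, smul_mul_assoc, weyl_mul]
  simp [UnitAddTorus.mFourier_zero]

lemma mFourier_pt (k : Fin n → ℤ) (s : EuclideanSpace ℝ (Fin n)) :
    UnitAddTorus.mFourier k (pt fun i => s i / (2 * Real.pi)) =
      ∏ j, Complex.exp (Complex.I * k j * s j) := by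
  rw [UnitAddTorus.mFourier, ContinuousMap.coe_mk]
  refine Finset.prod_congr rfl fun j _ => ?_
  rw [pt, fourier_coe_apply]
  congr 1
  have : (Real.pi : ℂ) ≠ 0 := by exact_mod_cast Real.pi_ne_zero
  push_cast
  field_simp

lemma contDiff_mFourier_pt (k : Fin n → ℤ) :
    ContDiff ℝ (⊤ : ℕ∞) fun s : EuclideanSpace ℝ (Fin n) =>
      UnitAddTorus.mFourier k (pt fun i => s i / (2 * Real.pi)) := by
  simp only [mFourier_pt]
  refine contDiff_prod fun j _ => ContDiff.cexp (contDiff_const.mul ?_)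
  exact Complex.ofRealCLM.contDiff.comp (EuclideanSpace.proj (𝕜 := ℝ) j).contDiff

lemma tauB_alpha (s : EuclideanSpace ℝ (Fin n)) (T : B n) : tauB (alpha s T) = tauB T := by
  have h : star (transl (pt fun i => s i / (2 * Real.pi)) : B n) (oneH n) = oneH n := by
    have h1 := transl_oneH (pt fun i => s i / (2 * Real.pi))
    have h2 : star (transl (pt fun i => s i / (2 * Real.pi)) : B n) *
      (transl (pt fun i => s i / (2 * Real.pi)) : B n) = 1 := Unitary.coe_star_mul_self _
    have h3 := congrArg (fun T : B n => T (oneH n)) h2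
    simp only [mul_apply_eq_comp, h1] at h3
    exact h3
  have h4 : alpha s T (oneH n) = (transl (pt fun i => s i / (2 * Real.pi)) : B n)
      (T (star (transl (pt fun i => s i / (2 * Real.pi)) : B n) (oneH n))) := rfl
  rw [tauB, tauB, h4, h, ← ContinuousLinearMap.adjoint_inner_left,
    ← ContinuousLinearMap.star_eq_adjoint, h]

lemma tauB_smul (c : ℂ) (T : B n) : tauB (c • T) = c * tauB T := by
  simp [tauB, inner_smul_right]

/-- `τ` is invariant under `α_s`, since translations fix the constant function, while `α_s`
multiplies the operator by a character of `s`. If this factor can be made different from `1`, the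
trace vanishes. -/
lemma tauB_weyl {k : Fin n → ℤ} (hk : k ≠ 0) (r : Torus n) : tauB (weyl k r : B n) = 0 := by
  obtain ⟨j, hj⟩ := Function.ne_iff.1 hk
  have hj' : (k j : ℂ) ≠ 0 := by exact_mod_cast hj
  -- A coordinate `π / k_j` makes the factor equal to `exp(iπ) = -1`.
  set s : EuclideanSpace ℝ (Fin n) := EuclideanSpace.single j (Real.pi / k j)
  have h := tauB_alpha s (weyl k r : B n)
  rw [alpha_weyl, tauB_smul, mFourier_pt, Finset.prod_eq_single j] at h
  · have : Complex.exp (Complex.I * k j * (s j : ℝ)) = -1 := by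
      rw [← Complex.exp_pi_mul_I]
      congr 1
      simp only [s, PiLp.single_apply, if_true]
      push_cast
      field_simp
    rw [this] at h
    linear_combination -(1 / 2) * h
  · intro i _ hi
    simp [s, hi]
  · simp

end Weyl

/-! ### The monomials `U^k` -/

variable {n : ℕ} {θ : SkewMatrix n}

/-- The half-translate `∑_j k_j θ_j / 2`. -/
def shift (θ : SkewMatrix n) (k : Fin n → ℤ) : Torus n := pt fun i => ∑ j, k j * (θ.1 i j / 2)

lemma shift_add (k l : Fin n → ℤ) : shift θ (k + l) = shift θ k + shift θ l := by
  ext i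
  simp [shift, pt, add_mul, Finset.sum_add_distrib]

lemma shift_zero : shift θ 0 = 0 := by
  ext i
  simp [shift, pt]

lemma shift_neg (k : Fin n → ℤ) : shift θ (-k) = -shift θ k :=
  eq_neg_of_add_eq_zero_left (by rw [← shift_add, neg_add_cancel, shift_zero])

lemma gen_eq_weyl (j : Fin n) : gen θ j = weyl (Pi.single j 1) (shift θ (Pi.single j 1)) := by
  have : shift θ (Pi.single j 1) = pt fun i => θ.1 i j / 2 := by
    ext i
    simp [shift, pt, Pi.single_apply]
  rw [this]
  rfl

/-- `T` is `U^k` up to a phase. -/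
def IsMonomial (θ : SkewMatrix n) (T : B n) (k : Fin n → ℤ) : Prop :=
  ∃ z : ℂ, z ≠ 0 ∧ T = z • (weyl k (shift θ k) : B n)

lemma IsMonomial.one : IsMonomial θ 1 0 :=
  ⟨1, one_ne_zero, by rw [shift_zero, weyl_zero, one_smul, OneMemClass.coe_one]⟩

lemma IsMonomial.mul {S T : B n} {k l : Fin n → ℤ} (hS : IsMonomial θ S k)
    (hT : IsMonomial θ T l) : IsMonomial θ (S * T) (k + l) := by
  obtain ⟨z, hz, rfl⟩ := hS
  obtain ⟨w, hw, rfl⟩ := hT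
  refine ⟨z * (w * UnitAddTorus.mFourier l (shift θ k)),
    mul_ne_zero hz (mul_ne_zero hw (mFourier_apply_ne_zero _ _)), ?_⟩
  rw [smul_mul_assoc, mul_smul_comm, weyl_mul, smul_smul, smul_smul, shift_add, mul_assoc]

lemma IsMonomial.star {T : B n} {k : Fin n → ℤ} (hT : IsMonomial θ T k) :
    IsMonomial θ (star T) (-k) := by
  obtain ⟨z, hz, rfl⟩ := hT
  refine ⟨Star.star z * (UnitAddTorus.mFourier (-k) (shift θ k))⁻¹,
    mul_ne_zero (star_ne_zero.2 hz) (inv_ne_zero (mFourier_apply_ne_zero _ _)), ?_⟩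
  rw [star_smul, star_weyl, smul_smul, shift_neg]

lemma IsMonomial.alpha {T : B n} {k : Fin n → ℤ} (hT : IsMonomial θ T k)
    (s : EuclideanSpace ℝ (Fin n)) :
    alpha s T = UnitAddTorus.mFourier k (pt fun i => s i / (2 * Real.pi)) • T := by
  obtain ⟨z, hz, rfl⟩ := hT
  have : NCTorus.alpha s (z • (weyl k (shift θ k) : B n)) =
      z • NCTorus.alpha s (weyl k (shift θ k) : B n) := by
    simp only [NCTorus.alpha, mul_smul_comm, smul_mul_assoc]
  rw [this, alpha_weyl, smul_comm]

lemma IsMonomial.tauB_eq_zero {T : B n} {k : Fin n → ℤ} (hT : IsMonomial θ T k) (hk : k ≠ 0) :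
    tauB T = 0 := by
  obtain ⟨z, hz, rfl⟩ := hT
  rw [tauB_smul, tauB_weyl hk, mul_zero]

lemma isMonomial_gen (j : Fin n) : IsMonomial θ (gen θ j : B n) (Pi.single j 1) :=
  ⟨1, one_ne_zero, by rw [gen_eq_weyl, one_smul]⟩

/-- The pairs of a unitary and a degree such that the unitary is a monomial of that degree form a
subgroup. It contains every `(U_j, e_j)`, hence the ordered product of their integer powers, which
is `(U^k, k)`. -/
lemma isMonomial_Upow (k : Fin n → ℤ) : IsMonomial θ (toB (Upow θ k : CTorus θ)) k := by
  let G : Subgroup (unitary (CTorus θ) × Multiplicative (Fin n → ℤ)) :=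
    { carrier := {p | IsMonomial θ (toB (p.1 : CTorus θ)) p.2.toAdd}
      mul_mem' := fun {p q} hp hq => by
        have := IsMonomial.mul hp hq
        rw [← map_mul] at this
        exact this
      one_mem' := by
        have h : toB (1 : CTorus θ) = 1 := map_one _
        change IsMonomial θ (toB (1 : CTorus θ)) 0
        rw [h]
        exact IsMonomial.one
      inv_mem' := fun {p} hp => by
        have := IsMonomial.star hp
        rw [← map_star] at this
        exact this }
  let L := List.ofFn fun j =>
    (U θ j, Multiplicative.ofAdd (Pi.single j (1 : ℤ) : Fin n → ℤ)) ^ k j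
  have hG : L.prod ∈ G := by
    refine Subgroup.list_prod_mem _ fun p hp => ?_
    obtain ⟨j, rfl⟩ := (List.mem_ofFn' _ _).1 hp
    exact G.zpow_mem (isMonomial_gen j) _
  have h1 : L.prod.1 = Upow θ k := by
    refine (map_list_prod (MonoidHom.fst _ _) L).trans ?_
    rw [List.map_ofFn]
    rfl
  have h2 : L.prod.2.toAdd = k := by
    have := map_list_prod (MonoidHom.snd _ _) L
    rw [List.map_ofFn, List.prod_ofFn] at this
    refine (congrArg Multiplicative.toAdd this).trans ?_
    rw [toAdd_prod]
    ext i
    simp [Finset.sum_apply, Pi.single_apply]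
  change IsMonomial θ (toB (L.prod.1 : CTorus θ)) L.prod.2.toAdd at hG
  rwa [h1, h2] at hG

/-- Needed for uniqueness: the extension conditions constrain an operator on smooth elements only.
-/
lemma isSmooth_Upow (k : Fin n → ℤ) : IsSmooth (Upow θ k : CTorus θ) := by
  unfold IsSmooth
  simp only [(isMonomial_Upow k).alpha]
  exact (contDiff_mFourier_pt k).smul contDiff_const

lemma tau_Upow_mul_star (k l : Fin n → ℤ) :
    tau θ ((Upow θ k : CTorus θ) * star (Upow θ l : CTorus θ)) = if k = l then 1 else 0 := by
  split_ifs with h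
  · rw [h, Unitary.mul_star_self_of_mem (Upow θ l).2]
    change tauB (toB 1) = 1
    rw [map_one, tauB]
    change ⟪oneH n, oneH n⟫_ℂ = 1
    have h1 : ‖oneH n‖ = 1 :=
      (Lp.norm_const' (p := 2) (μ := haar n) (c := (1 : ℂ)) (by simp) (by simp)).trans (by simp)
    rw [inner_self_eq_norm_sq_to_K, h1]
    simp
  · change tauB (toB _) = 0
    rw [map_mul, map_star]
    exact ((isMonomial_Upow k).mul (isMonomial_Upow l).star).tauB_eq_zero
      (by rwa [← sub_eq_add_neg, sub_ne_zero])

/-! ### The orthonormal basis `(U^k)` and Fourier coefficients. -/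

lemma orthonormal_Upow : Orthonormal ℂ fun k : Fin n → ℤ => toL2 (Upow θ k : CTorus θ) := by
  rw [orthonormal_iff_ite]
  intro l k
  rw [inner_toL2, tau_Upow_mul_star]
  simp only [eq_comm]

/-- The inclusion `C(𝕋ⁿ_θ) → L₂(𝕋ⁿ_θ)` as a bounded operator. -/
def toL2CLM (θ : SkewMatrix n) : CTorus θ →L[ℂ] L2 θ :=
  LinearMap.mkContinuous
    { toFun := toL2
      map_add' := fun a b => by
        rw [toL2, map_add, UniformSpace.Completion.coe_add]; rfl
      map_smul' := fun c a => by
        rw [toL2, map_smul, UniformSpace.Completion.coe_smul]; rfl } ‖toL2 (1 : CTorus θ)‖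
    fun a => by
      change ‖toL2 a‖ ≤ _
      have := norm_toPreGNS_mul_le (tau θ) a 1
      rw [mul_one] at this
      rw [toL2, UniformSpace.Completion.norm_coe, toL2, UniformSpace.Completion.norm_coe, mul_comm]
      exact this

/-- The generated `*`-algebra is the linear span of the words in the generators and their adjoints,
and every such word is a monomial, hence a multiple of some `U^k`. -/
lemma toB_mem_closure_span (a : CTorus θ) :
    toB a ∈ closure
      (Submodule.span ℂ (Set.range fun k => toB (Upow θ k : CTorus θ)) : Set (B n)) := by
  have h1 : (StarAlgebra.adjoin ℂ (Set.range fun j => (gen θ j : B n)) : Set (B n)) ⊆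
      Submodule.span ℂ (Set.range fun k => toB (Upow θ k : CTorus θ)) := by
    have h2 : ∀ T ∈ Submonoid.closure ((Set.range fun j => (gen θ j : B n)) ∪
        star (Set.range fun j => (gen θ j : B n))), ∃ k, IsMonomial θ T k := by
      intro T hT
      induction hT using Submonoid.closure_induction with
      | mem x hx =>
        rcases hx with ⟨j, rfl⟩ | hx
        · exact ⟨_, isMonomial_gen j⟩
        · obtain ⟨j, hj⟩ := hx
          refine ⟨-Pi.single j 1, ?_⟩
          rw [← star_star x, ← hj]
          exact (isMonomial_gen j).star
      | one => exact ⟨_, IsMonomial.one⟩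
      | mul x y _ _ hx hy =>
        obtain ⟨k, hk⟩ := hx
        obtain ⟨l, hl⟩ := hy
        exact ⟨_, hk.mul hl⟩
    have h3 := StarAlgebra.adjoin_eq_span (R := ℂ) (Set.range fun j => (gen θ j : B n))
    intro T hT
    have hT' : T ∈ Subalgebra.toSubmodule
      (StarAlgebra.adjoin ℂ (Set.range fun j => (gen θ j : B n))).toSubalgebra := hT
    rw [h3] at hT'
    refine Submodule.span_le.2 (fun S hS => ?_) hT'
    obtain ⟨k, z, hz, rfl⟩ := h2 S hS
    obtain ⟨w, hw, hk⟩ := isMonomial_Upow (θ := θ) k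
    have : z • (weyl k (shift θ k) : B n) = (z * w⁻¹) • toB (Upow θ k : CTorus θ) := by
      rw [hk, smul_smul, mul_assoc, inv_mul_cancel₀ hw, mul_one]
    rw [this]
    exact Submodule.smul_mem _ _ (Submodule.subset_span ⟨k, rfl⟩)
  exact closure_mono h1 a.2

lemma topologicalClosure_span_Upow :
    (Submodule.span ℂ (Set.range fun k => (Upow θ k : CTorus θ))).topologicalClosure = ⊤ := by
  refine eq_top_iff.2 fun a _ => ?_
  have h := toB_mem_closure_span a
  have hind : Topology.IsInducing (toB : CTorus θ → B n) := Topology.IsInducing.subtypeVal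
  change a ∈ closure _
  rw [hind.closure_eq_preimage_closure_image]
  have : (toB : CTorus θ → B n) '' (Submodule.span ℂ (Set.range fun k => (Upow θ k : CTorus θ))) =
      (Submodule.span ℂ (Set.range fun k => toB (Upow θ k : CTorus θ)) : Set (B n)) := by
    have := Submodule.map_span (toB (θ := θ)).toAlgHom.toLinearMap
      (Set.range fun k => (Upow θ k : CTorus θ))
    rw [← Set.range_comp] at this
    exact congrArg (fun S : Submodule ℂ (B n) => (S : Set (B n))) this
  change toB a ∈ closure ((toB : CTorus θ → B n) ''
    (Submodule.span ℂ (Set.range fun k => (Upow θ k : CTorus θ)) : Set (CTorus θ)))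
  rw [this]
  exact h

lemma denseRange_toL2 : DenseRange (toL2 : CTorus θ → L2 θ) :=
  UniformSpace.Completion.denseRange_coe (α := (tau θ).PreGNS)

/-- The Hilbert basis `(U^k)` of `L₂(𝕋ⁿ_θ)`. -/
def basisL2 (θ : SkewMatrix n) : HilbertBasis (Fin n → ℤ) ℂ (L2 θ) :=
  HilbertBasis.mk orthonormal_Upow <| by
    intro y _
    have h1 : ∀ a : CTorus θ, toL2 a ∈ (Submodule.span ℂ
        (Set.range fun k : Fin n → ℤ => toL2 (Upow θ k : CTorus θ))).topologicalClosure := by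
      intro a
      have ha : a ∈ (Submodule.span ℂ
          (Set.range fun k => (Upow θ k : CTorus θ))).topologicalClosure := by
        rw [topologicalClosure_span_Upow]; trivial
      have h2 : ∀ b ∈ Submodule.span ℂ (Set.range fun k => (Upow θ k : CTorus θ)),
          toL2CLM θ b ∈ Submodule.span ℂ
            (Set.range fun k : Fin n → ℤ => toL2 (Upow θ k : CTorus θ)) := by
        intro b hb
        have := Submodule.mem_map_of_mem (f := (toL2CLM θ).toLinearMap) hb
        rw [Submodule.map_span, ← Set.range_comp] at this
        exact this
      exact map_mem_closure (toL2CLM θ).continuous ha h2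
    exact (Submodule.isClosed_topologicalClosure _).closure_subset_iff.2
      (Set.range_subset_iff.2 h1) (denseRange_toL2 y)

lemma basisL2_apply (k : Fin n → ℤ) : basisL2 θ k = toL2 (Upow θ k : CTorus θ) := by
  rw [basisL2, HilbertBasis.coe_mk]

lemma inner_basisL2_toL2 (u : CTorus θ) (k : Fin n → ℤ) :
    ⟪basisL2 θ k, toL2 u⟫_ℂ = fourierCoeffNC u k := by
  rw [basisL2_apply, inner_toL2, fourierCoeffNC]

lemma hasSum_fourierCoeffNC (u : CTorus θ) :
    HasSum (fun k => fourierCoeffNC u k • basisL2 θ k) (toL2 u) := by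
  have := (basisL2 θ).hasSum_repr (toL2 u)
  simpa only [HilbertBasis.repr_apply_apply, inner_basisL2_toL2] using this

lemma summable_norm_fourierCoeffNC_sq (u : CTorus θ) :
    Summable fun k => ‖fourierCoeffNC u k‖ ^ 2 := by
  have := (basisL2 θ).orthonormal.inner_products_summable (toL2 u)
  simpa only [inner_basisL2_toL2] using this

lemma fourierCoeffNC_Upow (k l : Fin n → ℤ) :
    fourierCoeffNC (Upow θ k : CTorus θ) l = if k = l then 1 else 0 :=
  tau_Upow_mul_star k l

/-! ### Symbols -/

/-- Comparison with the sum of `‖k‖^{-m}` over the lattice `ℤⁿ`, which has rank `n`. -/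
lemma summable_one_add_norm_intPt_rpow {m : ℝ} (hm : (n : ℝ) < m) :
    Summable fun k : Fin n → ℤ => (1 + ‖intPt k‖) ^ (-m) := by
  let b := (EuclideanSpace.basisFun (Fin n) ℝ).toBasis
  let L := Submodule.span ℤ (Set.range b)
  have hfr : Module.finrank ℤ L = n := by
    rw [ZLattice.rank ℝ L]
    simp
  have hL := ZLattice.summable_norm_rpow L (-m) (by rw [hfr]; linarith)
  have hmem : ∀ k : Fin n → ℤ, intPt k ∈ L := by
    intro k
    rw [Module.Basis.mem_span_iff_repr_mem]
    intro i
    exact ⟨k i, by simp [b, intPt]⟩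
  have hinj : Function.Injective fun k : Fin n → ℤ => (⟨intPt k, hmem k⟩ : L) := by
    intro k l h
    have h1 : intPt k = intPt l := congrArg Subtype.val h
    ext i
    have h2 := congrArg (fun v : EuclideanSpace ℝ (Fin n) => v i) h1
    simpa [intPt] using h2
  -- The origin is excluded from the comparison because there `0 ^ (-m)` is `0` by convention.
  refine Summable.of_norm_bounded_eventually (hL.comp_injective hinj) ?_
  refine (Set.finite_singleton (0 : Fin n → ℤ)).subset fun k hk => ?_
  by_contra h0
  apply hk
  have hpos : 0 < ‖intPt k‖ := by
    rw [norm_pos_iff]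
    intro h
    apply h0
    ext i
    have h2 := congrArg (fun v : EuclideanSpace ℝ (Fin n) => v i) h
    simpa [intPt] using h2
  change ‖(1 + ‖intPt k‖) ^ (-m)‖ ≤ ‖intPt k‖ ^ (-m)
  rw [Real.norm_of_nonneg (by positivity)]
  exact Real.rpow_le_rpow_of_nonpos hpos (by linarith)
    (by have : (0 : ℝ) ≤ n := Nat.cast_nonneg n
        linarith)

lemma multiPow_zero {X : Type*} (D : Fin n → X → X) (v : X) : multiPow D 0 v = v := by
  rw [multiPow]
  induction List.finRange n with
  | nil => rfl
  | cons a l ih => rw [List.foldr_cons, ih]; rfl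

/-- The symbol estimate without derivatives, which controls the summability of `‖ρ(k)‖` and of
`‖ρ(k)‖²`. -/
lemma IsSymbol.exists_norm_le {m : ℝ} {ρ : EuclideanSpace ℝ (Fin n) → CTorus θ}
    (hρ : IsSymbol (-m) ρ) : ∃ C : ℝ, ∀ ξ, ‖ρ ξ‖ ≤ C * (1 + ‖ξ‖) ^ (-m) := by
  obtain ⟨C, hC⟩ := hρ.bound 0 0
  refine ⟨C, fun ξ => ?_⟩
  have h := hC ξ
  rw [multiPow_zero, multiPow_zero, norm_toB] at h
  simpa using h

lemma IsSymbol.summable_norm {m : ℝ} (hm : (n : ℝ) < m)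
    {ρ : EuclideanSpace ℝ (Fin n) → CTorus θ} (hρ : IsSymbol (-m) ρ) :
    Summable fun k => ‖ρ (intPt k)‖ := by
  obtain ⟨C, hC⟩ := hρ.exists_norm_le
  exact Summable.of_nonneg_of_le (fun k => norm_nonneg _) (fun k => hC _)
    ((summable_one_add_norm_intPt_rpow hm).mul_left C)

lemma IsSymbol.summable_norm_sq {m : ℝ} (hm : (n : ℝ) / 2 < m)
    {ρ : EuclideanSpace ℝ (Fin n) → CTorus θ} (hρ : IsSymbol (-m) ρ) :
    Summable fun k => ‖ρ (intPt k)‖ ^ 2 := by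
  obtain ⟨C, hC⟩ := hρ.exists_norm_le
  refine Summable.of_nonneg_of_le (fun k => sq_nonneg _) (fun k => ?_)
    ((summable_one_add_norm_intPt_rpow (m := 2 * m) (by linarith)).mul_left (C ^ 2))
  refine (pow_le_pow_left₀ (norm_nonneg _) (hC _) 2).trans_eq ?_
  rw [mul_pow, ← Real.rpow_natCast (_ ^ (-m)), ← Real.rpow_mul (by positivity)]
  congr 2
  push_cast
  ring

/-! ### Pseudodifferential operators -/

lemma norm_mul_Upow (a : CTorus θ) (k : Fin n → ℤ) : ‖a * (Upow θ k : CTorus θ)‖ = ‖a‖ :=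
  CStarRing.norm_mul_coe_unitary a (Upow θ k)

/-- The Fourier coefficients and the norms `‖ρ(k)‖` are both square-summable and `U^k` is unitary,
so the series converges absolutely in the C⋆-norm. It does so for every `u ∈ C(𝕋ⁿ_θ)`, so the `tsum`
in `psiDO` is a genuine sum. -/
lemma hasSum_psiDO {ρ : EuclideanSpace ℝ (Fin n) → CTorus θ}
    (hρ : Summable fun k => ‖ρ (intPt k)‖ ^ 2) (u : CTorus θ) :
    HasSum (fun k => fourierCoeffNC u k • (ρ (intPt k) * (Upow θ k : CTorus θ)))
      (psiDO ρ u) := by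
  refine (Summable.of_norm ?_).hasSum
  simp only [norm_smul, norm_mul_Upow]
  exact (summable_mul_and_tsum_mul_le_sqrt (fun k => norm_nonneg _) (fun k => norm_nonneg _)
    (summable_norm_fourierCoeffNC_sq u) hρ).1

lemma psiDO_Upow (ρ : EuclideanSpace ℝ (Fin n) → CTorus θ) (k : Fin n → ℤ) :
    psiDO ρ (Upow θ k : CTorus θ) = ρ (intPt k) * (Upow θ k : CTorus θ) := by
  rw [psiDO, tsum_eq_single k fun l hl => by rw [fourierCoeffNC_Upow, if_neg hl.symm, zero_smul],
    fourierCoeffNC_Upow, if_pos rfl, one_smul]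

lemma ext_basisL2 {S T : L2 θ →L[ℂ] L2 θ}
    (h : ∀ k, S (toL2 (Upow θ k : CTorus θ)) = T (toL2 (Upow θ k : CTorus θ))) : S = T := by
  refine ContinuousLinearMap.ext_on (s := Set.range (basisL2 θ)) ?_ ?_
  · exact Submodule.dense_iff_topologicalClosure_eq_top.2 (basisL2 θ).dense_span
  · rintro _ ⟨k, rfl⟩
    rw [basisL2_apply, h]

/-! ### Products in `L₂` -/

lemma continuous_mulL2_left (a : CTorus θ) : Continuous fun x : L2 θ => mulL2 x a :=
  (preMulRight a).completion.continuous

lemma toL2_add (a b : CTorus θ) : toL2 (a + b) = toL2 a + toL2 b := map_add (toL2CLM θ) a b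

lemma toL2_smul (c : ℂ) (a : CTorus θ) : toL2 (c • a) = c • toL2 a := map_smul (toL2CLM θ) c a

lemma norm_toL2 (a : CTorus θ) : ‖toL2 a‖ = ‖(tau θ).toPreGNS a‖ :=
  UniformSpace.Completion.norm_coe _

lemma norm_toL2_mul_le (x a : CTorus θ) : ‖toL2 (x * a)‖ ≤ ‖toL2 x‖ * ‖a‖ := by
  rw [norm_toL2, norm_toL2, mul_comm]
  exact norm_toPreGNS_mul_le_right (tau θ) (tau_mul_comm θ) a x

lemma norm_mulL2_le (x : L2 θ) (a : CTorus θ) : ‖mulL2 x a‖ ≤ ‖x‖ * ‖a‖ := by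
  refine denseRange_toL2.induction_on (p := fun x => ‖mulL2 x a‖ ≤ ‖x‖ * ‖a‖) x
    (isClosed_le (continuous_mulL2_left a).norm (by fun_prop)) fun y => ?_
  rw [mulL2_toL2]
  exact norm_toL2_mul_le y a

/-- `a ↦ x a` as a bounded operator from `C(𝕋ⁿ_θ)` to `L₂(𝕋ⁿ_θ)`. -/
def mulL2CLM (x : L2 θ) : CTorus θ →L[ℂ] L2 θ :=
  LinearMap.mkContinuous
    { toFun := mulL2 x
      map_add' := fun a b => by
        refine denseRange_toL2.induction_on
          (p := fun x => mulL2 x (a + b) = mulL2 x a + mulL2 x b) x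
          (isClosed_eq (continuous_mulL2_left _)
            ((continuous_mulL2_left a).add (continuous_mulL2_left b))) fun y => ?_
        rw [mulL2_toL2, mulL2_toL2, mulL2_toL2, mul_add, toL2_add]
      map_smul' := fun c a => by
        refine denseRange_toL2.induction_on
          (p := fun x => mulL2 x (c • a) = c • mulL2 x a) x
          (isClosed_eq (continuous_mulL2_left _) ((continuous_mulL2_left a).const_smul c))
          fun y => ?_
        rw [mulL2_toL2, mulL2_toL2, mul_smul_comm, toL2_smul] }
    ‖x‖ (norm_mulL2_le x)

/-! ### The trace formula for `λ(x) P_ρ`, `x ∈ L₂`. -/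

lemma inner_Upow_mulL2 (x : L2 θ) (a : CTorus θ) (k : Fin n → ℤ) :
    ⟪toL2 (Upow θ k : CTorus θ), mulL2 x (a * (Upow θ k : CTorus θ))⟫_ℂ = tauL2 (mulL2 x a) := by
  refine denseRange_toL2.induction_on (p := fun x =>
    ⟪toL2 (Upow θ k : CTorus θ), mulL2 x (a * (Upow θ k : CTorus θ))⟫_ℂ = tauL2 (mulL2 x a)) x
    (isClosed_eq (continuous_const.inner (continuous_mulL2_left _))
      (continuous_const.inner (continuous_mulL2_left _))) fun y => ?_
  rw [mulL2_toL2, mulL2_toL2, inner_toL2, tauL2_toL2, mul_assoc, mul_assoc,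
    Unitary.mul_star_self_of_mem (Upow θ k).2, mul_one]

theorem lambdaPsiDO_hasTrace {m : ℝ} (hm : (n : ℝ) < m)
    {ρ : EuclideanSpace ℝ (Fin n) → CTorus θ} (hρ : IsSymbol (-m) ρ) (x : L2 θ) :
    ∃ T : L2 θ →L[ℂ] L2 θ, ExtendsLambdaPsiDO x ρ T ∧
      (∀ S, ExtendsLambdaPsiDO x ρ S → S = T) ∧
      ∃ c : ℂ, HasTrace T c ∧
        HasSum (fun k : Fin n → ℤ => tauL2 (mulL2 x (ρ (intPt k)))) c := by
  have hρ2 : Summable fun k => ‖ρ (intPt k)‖ ^ 2 := by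
    refine hρ.summable_norm_sq ?_
    have : (0 : ℝ) ≤ n := Nat.cast_nonneg n
    linarith
  let a : (Fin n → ℤ) → L2 θ := fun k => mulL2 x (ρ (intPt k) * (Upow θ k : CTorus θ))
  have hab : Summable fun k => ‖a k‖ * ‖basisL2 θ k‖ := by
    refine Summable.of_nonneg_of_le (fun k => by positivity) (fun k => ?_)
      ((hρ.summable_norm hm).mul_left ‖x‖)
    rw [(basisL2 θ).orthonormal.1 k, mul_one, ← norm_mul_Upow _ k]
    exact norm_mulL2_le _ _
  let T : L2 θ →L[ℂ] L2 θ := ∑' k, InnerProductSpace.rankOne ℂ (a k) (basisL2 θ k)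
  have hT : ∀ u : CTorus θ, T (toL2 u) = mulL2 x (psiDO ρ u) := by
    intro u
    have h1 := hasSum_rankOne_apply hab (toL2 u)
    -- Applying the bounded map `a ↦ x a` to the norm-convergent series of `P_ρ u` gives the series
    -- of `T u`, term by term.
    have h2 := (hasSum_psiDO hρ2 u).mapL (mulL2CLM x)
    simp only [inner_basisL2_toL2] at h1
    simp only [map_smul] at h2
    exact h1.unique h2
  have hmat : ∀ k, ⟪basisL2 θ k, T (basisL2 θ k)⟫_ℂ = tauL2 (mulL2 x (ρ (intPt k))) := by
    intro k
    rw [basisL2_apply, hT, psiDO_Upow, inner_Upow_mulL2]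
  refine ⟨T, fun u _ => hT u, fun S hS => ext_basisL2 fun k => ?_, _, hasTrace_rankOne hab, ?_⟩
  · rw [hS _ (isSmooth_Upow k), hT]
  · have := (hasTrace_rankOne hab).2 _ (basisL2 θ)
    rwa [show (fun k => ⟪basisL2 θ k, T (basisL2 θ k)⟫_ℂ) = _ from funext hmat] at this

/-! ### Factorization in `L₁` -/

/-- Take `r = x(|x|+ε)^{-1/2}` and `s = (|x|+ε)^{1/2}`. Then `r^*r = |x|²/(|x|+ε) ≤ |x|` and `s^*s =
|x| + ε`. The shift by `ε` makes the inverse root available inside the C⋆-algebra. -/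
lemma exists_factorization {A : Type*} [CStarAlgebra A] [PartialOrder A] [StarOrderedRing A]
    (τ : A →ₚ[ℂ] ℂ) (x : A) {ε : ℝ} (hε : 0 < ε) :
    ∃ r s : A, x = r * s ∧ (τ (star r * r)).re ≤ (τ (CFC.abs x)).re ∧
      (τ (star s * s)).re ≤ (τ (CFC.abs x)).re + ε * (τ 1).re := by
  set h := CFC.abs x with hh
  have hpos : 0 ≤ h := CFC.abs_nonneg x
  have hsa : IsSelfAdjoint h := hpos.isSelfAdjoint
  have hspec : ∀ t ∈ spectrum ℝ h, 0 ≤ t := fun t ht => spectrum_nonneg_of_nonneg hpos ht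
  have hc : ContinuousOn (fun t : ℝ => (√(t + ε))⁻¹) (spectrum ℝ h) := by
    apply ContinuousOn.inv₀ (by fun_prop)
    intro t ht
    have := hspec t ht
    positivity
  have hc' : ContinuousOn (fun t : ℝ => √(t + ε)) (spectrum ℝ h) := by fun_prop
  set g := cfc (fun t : ℝ => (√(t + ε))⁻¹) h with hg
  set s := cfc (fun t : ℝ => √(t + ε)) h with hs
  have hgsa : star g = g := (cfc_predicate (R := ℝ) (p := IsSelfAdjoint) _ h).star_eq
  have hssa : star s = s := (cfc_predicate (R := ℝ) (p := IsSelfAdjoint) _ h).star_eq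
  have hid : h = cfc (fun t : ℝ => t) h := (cfc_id' ℝ h).symm
  have hxx : star x * x = h * h := (CFC.abs_mul_abs x).symm
  have hgs : g * s = 1 := by
    rw [hg, hs, ← cfc_mul _ _ h hc hc', ← cfc_one ℝ h]
    refine cfc_congr fun t ht => ?_
    have := hspec t ht
    exact inv_mul_cancel₀ (by positivity)
  refine ⟨x * g, s, by rw [mul_assoc, hgs, mul_one], ?_, ?_⟩
  · have h1 : star (x * g) * (x * g) =
        cfc (fun t : ℝ => (√(t + ε))⁻¹ * (t * t) * (√(t + ε))⁻¹) h := by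
      rw [cfc_mul (fun t : ℝ => (√(t + ε))⁻¹ * (t * t)) _ h (hc.mul (by fun_prop)) hc,
        cfc_mul _ (fun t : ℝ => t * t) h hc (by fun_prop),
        cfc_mul (fun t : ℝ => t) (fun t : ℝ => t) h (by fun_prop) (by fun_prop), ← hid, ← hxx,
        star_mul, hgsa]
      simp only [mul_assoc, hg]
    have h2 : star (x * g) * (x * g) ≤ h := by
      rw [h1]
      refine (cfc_mono (g := fun t : ℝ => t) (fun t ht => ?_) ((hc.mul (by fun_prop)).mul hc)
        (by fun_prop)).trans_eq hid.symm
      have h0 := hspec t ht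
      have hq : √(t + ε) * √(t + ε) = t + ε := Real.mul_self_sqrt (by positivity)
      calc (√(t + ε))⁻¹ * (t * t) * (√(t + ε))⁻¹ = t * t * (√(t + ε) * √(t + ε))⁻¹ := by
            rw [mul_inv]; ring
        _ = t * t / (t + ε) := by rw [hq, div_eq_mul_inv]
        _ ≤ t := by rw [div_le_iff₀ (by positivity)]; nlinarith
    have h3 : τ (star (x * g) * (x * g)) ≤ τ h := OrderHomClass.mono τ h2
    exact (Complex.le_def.1 h3).1
  · have h1 : star s * s = h + ε • (1 : A) := by
      rw [hssa, hs, ← cfc_mul _ _ h hc' hc']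
      have : cfc (fun t : ℝ => √(t + ε) * √(t + ε)) h = cfc (fun t : ℝ => t + ε) h :=
        cfc_congr fun t ht => Real.mul_self_sqrt (add_nonneg (hspec t ht) hε.le)
      rw [this, cfc_add_const ε (fun t : ℝ => t) h (by fun_prop), ← hid,
        Algebra.algebraMap_eq_smul_one]
    rw [h1, map_add, ← Complex.coe_smul, map_smul]
    simp

lemma tau_one : tau θ 1 = 1 := by
  have := tau_Upow_mul_star (θ := θ) 0 0
  rwa [Unitary.mul_star_self_of_mem (Upow θ 0).2, if_pos rfl] at this

lemma norm_toL2_sq (a : CTorus θ) : ‖toL2 a‖ ^ 2 = (tau θ (star a * a)).re := by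
  rw [norm_toL2]
  have := (tau θ).preGNS_norm_sq ((tau θ).toPreGNS a)
  rw [PositiveLinearMap.ofPreGNS_toPreGNS] at this
  rw [← this, ← Complex.ofReal_pow, Complex.ofReal_re]

lemma norm_toL2_star (a : CTorus θ) : ‖toL2 (star a)‖ = ‖toL2 a‖ := by
  rw [norm_toL2, norm_toL2, norm_toPreGNS_star (tau θ) (tau_mul_comm θ)]

lemma exists_mul_eq_norm_toL2_le (x : CTorus θ) {ε : ℝ} (hε : 0 < ε) :
    ∃ r s : CTorus θ, x = r * s ∧ ‖toL2 r‖ * ‖toL2 s‖ ≤ ‖toL1 x‖ + ε := by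
  obtain ⟨r, s, hx, hr, hs⟩ := exists_factorization (tau θ) x hε
  refine ⟨r, s, hx, ?_⟩
  rw [← norm_toL2_sq, ← norm_toL1] at hr
  rw [← norm_toL2_sq, ← norm_toL1, tau_one, Complex.one_re, mul_one] at hs
  -- The product of the two norms is at most half the sum of their squares, hence at most `‖x‖₁ +
  -- ε/2`.
  nlinarith [sq_nonneg (‖toL2 r‖ - ‖toL2 s‖)]

lemma denseRange_toL1 : DenseRange (toL1 : CTorus θ → L1 θ) :=
  UniformSpace.Completion.denseRange_coe (α := PreL1 θ)

/-- The inclusion `C(𝕋ⁿ_θ) → L₁(𝕋ⁿ_θ)` as a linear map. -/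
def toL1Linear (θ : SkewMatrix n) : CTorus θ →ₗ[ℂ] L1 θ :=
  UniformSpace.Completion.toComplL.toLinearMap ∘ₗ PreL1.of.toLinearMap

lemma toL1Linear_apply (a : CTorus θ) : toL1Linear θ a = toL1 a := rfl

/-- Every `x ∈ L₁(𝕋ⁿ_θ)` is a sum of products `r_j s_j` with `∑ ‖r_j‖₂ ‖s_j‖₂ < ∞`. -/
lemma exists_tendsto_sum_mul (x : L1 θ) :
    ∃ r s : ℕ → CTorus θ, Summable (fun j => ‖toL2 (r j)‖ * ‖toL2 (s j)‖) ∧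
      Filter.Tendsto (fun N => toL1 (∑ j ∈ Finset.range N, r j * s j)) Filter.atTop (nhds x) := by
  have hx : x ∈ closure ((LinearMap.range (toL1Linear θ)).toAddSubgroup : Set (L1 θ)) :=
    denseRange_toL1 x
  -- Telescoping writes `x` as a series of elements of `C(𝕋ⁿ_θ)` with L₁-norms below `2^{-j}`; each
  -- is then factored with error `2^{-j}`.
  obtain ⟨v, hv, hmem, -, hb⟩ := controlled_sum_of_mem_closure hx
    (b := fun j => (1 / 2 : ℝ) ^ j) fun j => by positivity
  choose y hy using hmem
  have hfac : ∀ j, ∃ r s : CTorus θ, y j = r * s ∧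
      ‖toL2 r‖ * ‖toL2 s‖ ≤ ‖toL1 (y j)‖ + (1 / 2 : ℝ) ^ j := fun j =>
    exists_mul_eq_norm_toL2_le (y j) (by positivity)
  choose r s hrs hle using hfac
  refine ⟨r, s, ?_, ?_⟩
  · have hgeo : Summable fun j : ℕ => (1 / 2 : ℝ) ^ j := summable_geometric_two
    -- The first term approximates `x` and need not be small, so the geometric bound starts at `j =
    -- 1`.
    refine (summable_nat_add_iff 1).1 (Summable.of_nonneg_of_le (fun j => by positivity)
      (fun j => ?_) ((summable_nat_add_iff 1).2 (hgeo.add hgeo)))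
    refine (hle (j + 1)).trans (add_le_add ?_ le_rfl)
    have := hb (j + 1) (Nat.succ_pos j)
    rw [← hy (j + 1)] at this
    exact this.le
  · refine (Filter.tendsto_add_atTop_iff_nat 1).1 (hv.congr fun N => ?_)
    rw [← toL1Linear_apply, map_sum]
    refine Finset.sum_congr rfl fun j _ => ?_
    rw [← hrs, hy]

/-! ### The sesquilinear form `λ(x)` -/

lemma continuous_lambdaL1 (u v : CTorus θ) : Continuous fun x : L1 θ => lambdaL1 x u v :=
  UniformSpace.Completion.continuous_extension.comp (preMulL1 (star v) u).completion.continuous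

lemma lambdaL1_toL1 (x u v : CTorus θ) : lambdaL1 (toL1 x) u v = tau θ (star v * x * u) := by
  rw [lambdaL1, mulL1_toL1, tauL1_toL1]

lemma norm_lambdaL1_le (x : L1 θ) (u v : CTorus θ) :
    ‖lambdaL1 x u v‖ ≤ ‖x‖ * ‖v‖ * ‖u‖ := by
  refine denseRange_toL1.induction_on (p := fun x => ‖lambdaL1 x u v‖ ≤ ‖x‖ * ‖v‖ * ‖u‖) x
    (isClosed_le (continuous_lambdaL1 u v).norm (by fun_prop)) fun y => ?_
  -- By cyclicity `τ(v^* y u) = τ(u v^* y)`, to which the duality bound `|τ(z y)| ≤ ‖z‖ τ(|y|)`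
  -- applies.
  rw [lambdaL1_toL1, mul_assoc, tau_mul_comm, mul_assoc, tau_mul_comm, norm_toL1]
  refine (norm_apply_mul_le (tau θ) (tau_mul_comm θ) (u * star v) y).trans ?_
  have h3 : 0 ≤ (tau θ (CFC.abs y)).re :=
    (Complex.nonneg_iff.1 ((tau θ).map_nonneg (CFC.abs_nonneg y))).1
  have h4 := norm_mul_le u (star v)
  rw [norm_star] at h4
  nlinarith

/-- `u ↦ ⟨λ(x) u, v⟩` as a bounded functional. -/
def lambdaL1CLM (x : L1 θ) (v : CTorus θ) : CTorus θ →L[ℂ] ℂ :=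
  LinearMap.mkContinuous
    { toFun := fun u => lambdaL1 x u v
      map_add' := fun a b => by
        refine denseRange_toL1.induction_on
          (p := fun x => lambdaL1 x (a + b) v = lambdaL1 x a v + lambdaL1 x b v) x
          (isClosed_eq (continuous_lambdaL1 _ _)
            ((continuous_lambdaL1 _ _).add (continuous_lambdaL1 _ _))) fun y => ?_
        rw [lambdaL1_toL1, lambdaL1_toL1, lambdaL1_toL1, mul_add, map_add]
      map_smul' := fun c a => by
        refine denseRange_toL1.induction_on
          (p := fun x => lambdaL1 x (c • a) v = c • lambdaL1 x a v) x
          (isClosed_eq (continuous_lambdaL1 _ _) ((continuous_lambdaL1 _ _).const_smul c))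
          fun y => ?_
        rw [lambdaL1_toL1, lambdaL1_toL1, mul_smul_comm, map_smul] }
    (‖x‖ * ‖v‖) fun u => norm_lambdaL1_le x u v

/-- `v ↦ ⟨λ(x) u, v⟩` as a bounded antilinear functional. -/
def lambdaL1CLMStar (x : L1 θ) (u : CTorus θ) : CTorus θ →L⋆[ℂ] ℂ :=
  LinearMap.mkContinuous
    { toFun := fun v => lambdaL1 x u v
      map_add' := fun a b => by
        refine denseRange_toL1.induction_on
          (p := fun x => lambdaL1 x u (a + b) = lambdaL1 x u a + lambdaL1 x u b) x
          (isClosed_eq (continuous_lambdaL1 _ _)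
            ((continuous_lambdaL1 _ _).add (continuous_lambdaL1 _ _))) fun y => ?_
        rw [lambdaL1_toL1, lambdaL1_toL1, lambdaL1_toL1, star_add, add_mul, add_mul, map_add]
      map_smul' := fun c a => by
        refine denseRange_toL1.induction_on
          (p := fun x => lambdaL1 x u (c • a) = (starRingEnd ℂ) c • lambdaL1 x u a) x
          (isClosed_eq (continuous_lambdaL1 _ _) (continuous_const.mul (continuous_lambdaL1 _ _)))
          fun y => ?_
        rw [lambdaL1_toL1, lambdaL1_toL1, star_smul, smul_mul_assoc, smul_mul_assoc, map_smul]
        rfl }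
    (‖x‖ * ‖u‖) fun v => (norm_lambdaL1_le x u v).trans_eq (by ring)

/-- By cyclicity of `τ`, the two unitaries meet as `U^k (U^k)^* = 1` between `a` and `b^*`; density
extends this to `x ∈ L₁`. -/
lemma lambdaL1_mul_Upow (x : L1 θ) (a b : CTorus θ) (k : Fin n → ℤ) :
    lambdaL1 x (a * (Upow θ k : CTorus θ)) (b * (Upow θ k : CTorus θ)) =
      tauL1 (mulL1 1 x (a * star b)) := by
  have h : ∀ c : CTorus θ, tauL1 (mulL1 1 x c) = lambdaL1 x c 1 := fun c => by
    rw [lambdaL1, star_one]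
  rw [h]
  refine denseRange_toL1.induction_on (p := fun x =>
    lambdaL1 x (a * (Upow θ k : CTorus θ)) (b * (Upow θ k : CTorus θ)) =
      lambdaL1 x (a * star b) 1) x
    (isClosed_eq (continuous_lambdaL1 _ _) (continuous_lambdaL1 _ _)) fun y => ?_
  rw [lambdaL1_toL1, lambdaL1_toL1, mul_assoc, tau_mul_comm, star_mul, star_one, one_mul]
  have : y * (a * (Upow θ k : CTorus θ)) * (star (Upow θ k : CTorus θ) * star b) =
      y * a * ((Upow θ k : CTorus θ) * star (Upow θ k : CTorus θ)) * star b := by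
    simp only [mul_assoc]
  rw [this, Unitary.mul_star_self_of_mem (Upow θ k).2, mul_one, mul_assoc]

/-! ### The trace formula for `P_σ^* λ(x) P_ρ`, `x ∈ L₁`. -/

lemma hasSum_star_fourierCoeffNC_mul_inner (v : CTorus θ) (y : L2 θ) :
    HasSum (fun l => star (fourierCoeffNC v l) * ⟪basisL2 θ l, y⟫_ℂ) ⟪toL2 v, y⟫_ℂ := by
  have h := (basisL2 θ).hasSum_inner_mul_inner (toL2 v) y
  refine h.congr_fun fun l => ?_
  rw [← inner_conj_symm (toL2 v), inner_basisL2_toL2]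
  rfl

/-- The Hilbert–Schmidt bound for the operator `U^k ↦ y p_k U^k`. Traciality makes right
multiplication bounded on L₂, so each column has norm at most `‖y‖₂ ‖p_k‖`. -/
lemma summable_norm_toL2_mul_Upow_sq (y : CTorus θ) {p : (Fin n → ℤ) → CTorus θ}
    (hp : Summable fun k => ‖p k‖ ^ 2) :
    Summable (fun k => ‖toL2 (y * (p k * (Upow θ k : CTorus θ)))‖ ^ 2) ∧
      √(∑' k, ‖toL2 (y * (p k * (Upow θ k : CTorus θ)))‖ ^ 2) ≤
        ‖toL2 y‖ * √(∑' k, ‖p k‖ ^ 2) := by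
  have hle : ∀ k, ‖toL2 (y * (p k * (Upow θ k : CTorus θ)))‖ ^ 2 ≤
      ‖toL2 y‖ ^ 2 * ‖p k‖ ^ 2 := fun k => by
    rw [← mul_pow, ← norm_mul_Upow (p k) k]
    exact pow_le_pow_left₀ (norm_nonneg _) (norm_toL2_mul_le _ _) 2
  have hs := Summable.of_nonneg_of_le (fun k => sq_nonneg _) hle (hp.mul_left (‖toL2 y‖ ^ 2))
  refine ⟨hs, ?_⟩
  calc √(∑' k, ‖toL2 (y * (p k * (Upow θ k : CTorus θ)))‖ ^ 2)
      ≤ √(∑' k, ‖toL2 y‖ ^ 2 * ‖p k‖ ^ 2) :=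
        Real.sqrt_le_sqrt (hs.tsum_le_tsum hle (hp.mul_left _))
    _ = ‖toL2 y‖ * √(∑' k, ‖p k‖ ^ 2) := by
        rw [tsum_mul_left, Real.sqrt_mul (sq_nonneg _), Real.sqrt_sq (norm_nonneg _)]

/-- A trace-class operator with the matrix `⟨λ(x) p_k U^k, q_l U^l⟩`, for `x ∈ L₁(𝕋ⁿ_θ)` and
square-summable `p` and `q`. -/
lemma exists_hasTrace_inner_eq_lambdaL1 (x : L1 θ) {p q : (Fin n → ℤ) → CTorus θ}
    (hp : Summable fun k => ‖p k‖ ^ 2) (hq : Summable fun k => ‖q k‖ ^ 2) :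
    ∃ T : L2 θ →L[ℂ] L2 θ, (∃ c, HasTrace T c) ∧ ∀ l k,
      ⟪basisL2 θ l, T (basisL2 θ k)⟫_ℂ =
        lambdaL1 x (p k * (Upow θ k : CTorus θ)) (q l * (Upow θ l : CTorus θ)) := by
  obtain ⟨r, s, hrs, hx⟩ := exists_tendsto_sum_mul x
  have hr := fun j => summable_norm_toL2_mul_Upow_sq (star (r j)) hq
  have hs := fun j => summable_norm_toL2_mul_Upow_sq (s j) hp
  -- For each `j`, moving `r_j` to the other side shows `⟨r_j s_j p_k U^k, q_l U^l⟩ = ⟨s_j p_k U^k,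
  -- r_j^* q_l U^l⟩`, the matrix of a product of two Hilbert–Schmidt operators.
  choose a b hab hle hmat using fun j => exists_rankOne_of_inner (basisL2 θ)
    (fun l => toL2 (star (r j) * (q l * (Upow θ l : CTorus θ))))
    (fun k => toL2 (s j * (p k * (Upow θ k : CTorus θ)))) (hr j).1 (hs j).1
  have hsum : Summable fun i : ℕ × (Fin n → ℤ) => ‖a i.1 i.2‖ * ‖b i.1 i.2‖ := by
    refine (summable_prod_of_nonneg fun i => by positivity).2 ⟨hab, ?_⟩
    refine Summable.of_nonneg_of_le (fun j => tsum_nonneg fun i => by positivity) (fun j => ?_)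
      (hrs.mul_right (√(∑' k, ‖q k‖ ^ 2) * √(∑' k, ‖p k‖ ^ 2)))
    refine (hle j).trans ((mul_le_mul (hr j).2 (hs j).2 (Real.sqrt_nonneg _)
      (by positivity)).trans_eq ?_)
    rw [norm_toL2_star]
    ring
  refine ⟨_, ⟨_, hasTrace_rankOne hsum⟩, fun l k => ?_⟩
  set P := p k * (Upow θ k : CTorus θ)
  set Q := q l * (Upow θ l : CTorus θ)
  -- The partial sums over `j` of the matrix entries converge to the entry of `T`, and, by
  -- continuity of `λ(·)` on L₁, also to the entry for `x`.
  have h1 := (hasSum_inner_rankOne_apply hsum (basisL2 θ l) (basisL2 θ k)).prod_fiberwise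
    fun j => hmat j l k
  have h2 := ((continuous_lambdaL1 P Q).tendsto x).comp hx
  refine tendsto_nhds_unique h1.tendsto_sum_nat (h2.congr fun N => ?_)
  change lambdaL1 (toL1 _) P Q = _
  rw [lambdaL1_toL1, Finset.mul_sum, Finset.sum_mul, map_sum]
  refine Finset.sum_congr rfl fun j _ => ?_
  rw [inner_toL2, star_mul (star (r j)), star_star, tau_mul_comm θ (s j * _)]
  simp only [P, Q, mul_assoc]

theorem sandwichPsiDO_hasTrace {m : ℝ} (hm : (n : ℝ) / 2 < m)
    {ρ σ : EuclideanSpace ℝ (Fin n) → CTorus θ} (hρ : IsSymbol (-m) ρ) (hσ : IsSymbol (-m) σ)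
    (x : L1 θ) :
    ∃ T : L2 θ →L[ℂ] L2 θ, ExtendsSandwichPsiDO x σ ρ T ∧
      (∀ S, ExtendsSandwichPsiDO x σ ρ S → S = T) ∧
      ∃ c : ℂ, HasTrace T c ∧ HasSum (fun k : Fin n → ℤ =>
        tauL1 (mulL1 1 x (ρ (intPt k) * star (σ (intPt k))))) c := by
  have hρ2 := hρ.summable_norm_sq hm
  have hσ2 := hσ.summable_norm_sq hm
  obtain ⟨T, ⟨c, hc⟩, hmat⟩ := exists_hasTrace_inner_eq_lambdaL1 x hρ2 hσ2
  -- The identity known on basis vectors is extended one variable at a time: first in `v` by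
  -- antilinear continuity, then in `u` by linear continuity.
  have hT1 : ∀ (v : CTorus θ) (k : Fin n → ℤ), ⟪toL2 v, T (basisL2 θ k)⟫_ℂ =
      lambdaL1 x (ρ (intPt k) * (Upow θ k : CTorus θ)) (psiDO σ v) := by
    intro v k
    have h1 := hasSum_star_fourierCoeffNC_mul_inner v (T (basisL2 θ k))
    simp only [hmat] at h1
    have h2 := (hasSum_psiDO hσ2 v).mapL
      (lambdaL1CLMStar x (ρ (intPt k) * (Upow θ k : CTorus θ)))
    simp only [map_smulₛₗ] at h2
    exact h1.unique h2
  have hT : ∀ u v : CTorus θ, ⟪toL2 v, T (toL2 u)⟫_ℂ = lambdaL1 x (psiDO ρ u) (psiDO σ v) := by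
    intro u v
    have h1 := ((hasSum_fourierCoeffNC u).mapL T).mapL (innerSL ℂ (toL2 v))
    simp only [map_smul, innerSL_apply_apply, hT1] at h1
    have h2 := (hasSum_psiDO hρ2 u).mapL (lambdaL1CLM x (psiDO σ v))
    simp only [map_smul] at h2
    exact h1.unique h2
  refine ⟨T, fun u v _ _ => hT u v, fun S hS => ext_basisL2 fun k => ?_, c, hc, ?_⟩
  -- The form fixes every matrix entry of `S` on the smooth vectors `U^k`, `U^l`, so `S U^k` and `T
  -- U^k` have the same coefficients.
  · rw [← sub_eq_zero]
    refine (basisL2 θ).repr.injective ?_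
    ext l
    rw [HilbertBasis.repr_apply_apply, basisL2_apply, inner_sub_right,
      hS _ _ (isSmooth_Upow k) (isSmooth_Upow l), hT, sub_self, map_zero]
    rfl
  · have h1 := hc.2 _ (basisL2 θ)
    have h2 : ∀ k, ⟪basisL2 θ k, T (basisL2 θ k)⟫_ℂ =
        tauL1 (mulL1 1 x (ρ (intPt k) * star (σ (intPt k)))) := fun k => by
      rw [hmat, lambdaL1_mul_Upow]
    rwa [show (fun k => ⟪basisL2 θ k, T (basisL2 θ k)⟫_ℂ) = _ from funext h2] at h1

end NCTorus

end

theorem mainTheorem3 {n : ℕ} (hn : 2 ≤ n) (θ : NCTorus.SkewMatrix n) (m : ℝ) :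
    ((n : ℝ) < m →
      ∀ ρ : EuclideanSpace ℝ (Fin n) → NCTorus.CTorus θ, NCTorus.IsSymbol (-m) ρ →
      ∀ x : NCTorus.L2 θ,
      ∃ T : NCTorus.L2 θ →L[ℂ] NCTorus.L2 θ,
        NCTorus.ExtendsLambdaPsiDO x ρ T ∧
        (∀ S, NCTorus.ExtendsLambdaPsiDO x ρ S → S = T) ∧
        ∃ c : ℂ, NCTorus.HasTrace T c ∧
          HasSum (fun k : Fin n → ℤ =>
            NCTorus.tauL2 (NCTorus.mulL2 x (ρ (NCTorus.intPt k)))) c) ∧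
    ((n : ℝ) / 2 < m →
      ∀ ρ σ : EuclideanSpace ℝ (Fin n) → NCTorus.CTorus θ,
      NCTorus.IsSymbol (-m) ρ → NCTorus.IsSymbol (-m) σ →
      ∀ x : NCTorus.L1 θ,
      ∃ T : NCTorus.L2 θ →L[ℂ] NCTorus.L2 θ,
        NCTorus.ExtendsSandwichPsiDO x σ ρ T ∧
        (∀ S, NCTorus.ExtendsSandwichPsiDO x σ ρ S → S = T) ∧
        ∃ c : ℂ, NCTorus.HasTrace T c ∧
          HasSum (fun k : Fin n → ℤ =>
            NCTorus.tauL1 (NCTorus.mulL1 1 x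
              (ρ (NCTorus.intPt k) * star (σ (NCTorus.intPt k))))) c) ∧
    ((n : ℝ) / 2 < m →
      ∀ ρ : EuclideanSpace ℝ (Fin n) → NCTorus.CTorus θ, NCTorus.IsSymbol (-m) ρ →
      ∀ x : NCTorus.L1 θ,
      ∃ T : NCTorus.L2 θ →L[ℂ] NCTorus.L2 θ,
        NCTorus.ExtendsSandwichPsiDO x ρ ρ T ∧
        (∀ S, NCTorus.ExtendsSandwichPsiDO x ρ ρ S → S = T) ∧
        ∃ c : ℂ, NCTorus.HasTrace T c ∧
          HasSum (fun k : Fin n → ℤ =>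
            NCTorus.tauL1 (NCTorus.mulL1 1 x
              (CFC.abs (star (ρ (NCTorus.intPt k))) ^ 2))) c) := by
  refine ⟨fun hm ρ hρ x => NCTorus.lambdaPsiDO_hasTrace hm hρ x,
    fun hm ρ σ hρ hσ x => NCTorus.sandwichPsiDO_hasTrace hm hρ hσ x, fun hm ρ hρ x => ?_⟩
  -- The last formula is the case `σ = ρ` of the second, once `|a^*|²` is rewritten as `a a^*`.
  have h : ∀ a : NCTorus.CTorus θ, CFC.abs (star a) ^ 2 = a * star a := fun a => by
    rw [pow_two, CFC.abs_mul_abs, star_star]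
  simp only [h]
  exact NCTorus.sandwichPsiDO_hasTrace hm hρ hρ x
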